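/- Let $N\ge 1$ be an integer and let $0<\alpha<2$. For $g\in S(\mathbb R)$ write $\widehat g(\xi)=(2\pi)^{-1/2}\int_{\mathbb R}e^{-is\xi}g(s)\,ds$. Let $\psi$ be a Lemarié–Meyer mother wavelet: a real-valued function in the Schwartz class $S(\mathbb R)$ such that the support of $\widehat\psi$ is contained in $\{\xi\in\mathbb R: 2\pi/3\le|\xi|\le 8\pi/3\}$ and such that the functions $\psi_{j,k}(x)=2^{j/2}\psi(2^jx-k)$, $(j,k)\in\mathbb Z^2$, form an orthonormal basis of $L^2(\mathbb R)$. For $J=(j_1,\dots,j_N)$, $K=(k_1,\dots,k_N)\in\mathbb Z^N$ put $$\widehat\Psi_{\alpha,J,K}(\lambda)=\prod_{l=1}^N 2^{-j_l(\frac1\alpha-\frac12)}\,\widehat\psi_{j_l,k_l}(\lambda_l),\qquad \lambda\in\mathbb R^N .$$ Let $\widetilde M_\alpha$ be a complex-valued rotationally invariant $\alpha$-stable random measure on $\mathbb R^N$ with Lebesgue control measure, defined on a probability space $(\Omega,\mathcal F,\mathbb P)$; that is, an independently scattered, (almost surely) $\sigma$-additive random set function on the Borel sets $A$ of finite Lebesgue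 measure $|A|$ with $$\mathbb E\exp\big(i\,\mathrm{Re}(\overline\theta\,\widetilde M_\alpha(A))\big)=\exp(-|\theta|^\alpha|A|),\qquad\theta\in\mathbb C.$$ For $f\in L^\alpha(\mathbb R^N)$ the integral $\int f\,d\widetilde M_\alpha$ is the limit in probability of the integrals of simple functions (vanishing outside sets of finite measure) converging to $f$ in $L^\alpha(\mathbb R^N)$. Let $$\epsilon_{J,K}=\int_{\mathbb R^N}\overline{\widehat\Psi_{\alpha,J,K}(\lambda)}\,\widetilde M_\alpha(d\lambda),\qquad (J,K)\in\mathbb Z^N\times\mathbb Z^N .$$ Then there is an event $\Omega^*$ of probability $1$ such that for every $\eta>0$ there exists a random variable $C>0$ with the following property. (i) If $\alpha\in(0,1)$, then for every $\omega\in\Omega^*$ and all $(J,K)\in\mathbb Z^N\times\mathbb Z^N$, $$|\epsilon_{J,K}(\omega)|\le C(\omega)\prod_{l=1}^N(1+|j_l|)^{1/\alpha+\eta}.$$ (ii) If $\alpha\in[1,2)$, then for every $\omega\in\Omega^*$ and all $(J,K)\in\mathbb Z^N\times\mathbb Z^N$, $$|\epsilon_{J,K}(\omega)|\le C(\omega)\prod_{l=1}^N(1+|j_l|)^{1/\alpha+\eta}\sqrt{\log(2+|j_l|)}\,\sqrt{\log(2+|k_l|)}.$$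 -/

import Mathlib

open MeasureTheory ProbabilityTheory Filter
open scoped Topology SchwartzMap ComplexConjugate ENNReal

noncomputable section

namespace HFSS

/-- The unitary Fourier transform `(2π)^(-1/2) ∫ e^{-isξ} g(s) ds` on the real line. -/
def fourierU (g : ℝ → ℂ) (ξ : ℝ) : ℂ :=
  (((2 * Real.pi) ^ (-(1 / 2) : ℝ) : ℝ) : ℂ) *
    ∫ s : ℝ, Complex.exp (-(Complex.I * s * ξ)) * g s

/-- The dilated and translated wavelet `ψ_{j,k}(x) = 2^{j/2} ψ(2^j x - k)`, seen as a
complex-valued function. -/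
def psi (ψ : 𝓢(ℝ, ℝ)) (j k : ℤ) (x : ℝ) : ℂ :=
  (((2 : ℝ) ^ ((j : ℝ) / 2) * ψ ((2 : ℝ) ^ j * x - k) : ℝ) : ℂ)

/-- Lemarié–Meyer mother wavelets: real-valued Schwartz functions whose Fourier transform is
supported in the ring `2π/3 ≤ |ξ| ≤ 8π/3` and whose dyadic dilates and integer translates form
an orthonormal basis of `L²(ℝ)`. -/
structure IsLemarieMeyer (ψ : 𝓢(ℝ, ℝ)) : Prop where
  tsupport_subset : tsupport (fourierU fun x => (ψ x : ℂ)) ⊆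
    {ξ : ℝ | 2 * Real.pi / 3 ≤ |ξ| ∧ |ξ| ≤ 8 * Real.pi / 3}
  orthonormal_basis : ∃ b : HilbertBasis (ℤ × ℤ) ℂ (Lp ℂ 2 (volume : Measure ℝ)),
    ∀ j k : ℤ, (b (j, k) : ℝ → ℂ) =ᵐ[volume] psi ψ j k

/-- The renormalized Fourier transform
`2^{-j(1/α - 1/2)}` times the Fourier transform of `ψ_{j,k}`. -/
def hatPsi (α : ℝ) (ψ : 𝓢(ℝ, ℝ)) (j k : ℤ) (ξ : ℝ) : ℂ :=
  (((2 : ℝ) ^ (-(j : ℝ) * (1 / α - 1 / 2)) : ℝ) : ℂ) * fourierU (psi ψ j k) ξ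

/-- The tensor product `∏_l hatPsi_{α,j_l,k_l}(x_l)` on `ℝ^N`. -/
def hatPsiTensor {N : ℕ} (α : ℝ) (ψ : 𝓢(ℝ, ℝ)) (J K : Fin N → ℤ) (x : Fin N → ℝ) : ℂ :=
  ∏ l, hatPsi α ψ (J l) (K l) (x l)

/-- `M` is a complex-valued rotationally invariant `α`-stable random measure on `ℝ^N` with
Lebesgue control measure, on the probability space `(Ω, P)`: an independently scattered random
set function on the Borel sets of finite Lebesgue measure, almost surely countably additive along
each fixed disjoint sequence, such that `M A` is isotropic with
`E exp(i Re(conj θ * M A)) = exp(-|θ|^α |A|)`.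
The values of `M` on other sets are irrelevant. -/
structure IsStableRandomMeasure {N : ℕ} {Ω : Type*} [MeasurableSpace Ω] (α : ℝ) (P : Measure Ω)
    (M : Set (Fin N → ℝ) → Ω → ℂ) : Prop where
  measurable : ∀ A, MeasurableSet A → volume A < ∞ → Measurable (M A)
  indep : ∀ (n : ℕ) (A : Fin n → Set (Fin N → ℝ)), (∀ i, MeasurableSet (A i)) →
    (∀ i, volume (A i) < ∞) → Pairwise (Function.onFun Disjoint A) →
    iIndepFun (fun i => M (A i)) P
  sigma_additive : ∀ A : ℕ → Set (Fin N → ℝ), (∀ i, MeasurableSet (A i)) →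
    volume (⋃ i, A i) < ∞ → Pairwise (Function.onFun Disjoint A) →
    ∀ᵐ ω ∂P, Tendsto (fun n => ∑ i ∈ Finset.range n, M (A i) ω) atTop (𝓝 (M (⋃ i, A i) ω))
  charFun_eq : ∀ A, MeasurableSet A → volume A < ∞ → ∀ θ : ℂ,
    charFun (P.map (M A)) θ = ((Real.exp (-(‖θ‖ ^ α * volume.real A)) : ℝ) : ℂ)

/-- The integral `∑_z z M(f = z)` of a simple function. -/
def simpleIntegral {N : ℕ} {Ω : Type*} (M : Set (Fin N → ℝ) → Ω → ℂ)
    (f : SimpleFunc (Fin N → ℝ) ℂ) (ω : Ω) : ℂ :=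
  ∑ z ∈ f.range, z * M (f ⁻¹' {z}) ω

/-- The random variable `I` is (a version of) the stochastic integral of `f ∈ L^α(ℝ^N)` with
respect to `M`: the limit in probability of the integrals of simple functions, supported on sets
of finite measure, that converge to `f` in `L^α`. -/
structure IsStableIntegral {N : ℕ} {Ω : Type*} [MeasurableSpace Ω] (α : ℝ) (P : Measure Ω)
    (M : Set (Fin N → ℝ) → Ω → ℂ) (f : (Fin N → ℝ) → ℂ) (I : Ω → ℂ) : Prop where
  measurable : Measurable I
  memLp : MemLp f (ENNReal.ofReal α) volume
  exists_approx : ∃ g : ℕ → SimpleFunc (Fin N → ℝ) ℂ,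
    (∀ n, (g n).FinMeasSupp volume) ∧
    Tendsto (fun n => eLpNorm (fun x => g n x - f x) (ENNReal.ofReal α) volume) atTop (𝓝 0) ∧
    TendstoInMeasure P (fun n => simpleIntegral M (g n)) atTop I

end HFSS

end

/-!
The modulus of `hatPsiTensor α ψ J K` does not depend on `K`, and by the choice of normalization the
integral of its `α`-th power does not depend on `J` either. Hence for each `J` all the `ε J K` are
integrals of functions with a common majorant, whose `L^α` norm is the same for all `J`.

Finitely many such integrals are close to linear forms `∑ i, c i k * M (A i)` in the masses of
common disjoint cells. If `α < 1`, the weighted sum of the moduli `‖M (A i)‖` dominates all these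
forms at once and has tail `x ^ (-α)`. If `α < 2`, the same holds for the weighted sum of squares,
with tail `y ^ (-α / 2)`; where it is at most `y`, each form is sub-Gaussian with variance proxy of
order `y`, because the masses are independent and symmetric, and the logarithms pay for the union
bound over `(J, K)`. The powers `(1 + |j_l|) ^ (1 / α + η)` make the heavy tails summable over `J`.
-/

namespace HFSS

section Tails

variable {E : Type*} [MeasurableSpace E] [NormedAddCommGroup E] [InnerProductSpace ℝ E]

lemma measureReal_abs_inner_gt_le_of_norm_one_sub_charFun_le [OpensMeasurableSpace E]
    {μ : Measure E} [IsProbabilityMeasure μ] {α s : ℝ} (hα : 0 ≤ α) (hs : 0 ≤ s)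
    (hμ : ∀ θ, ‖1 - charFun μ θ‖ ≤ s * ‖θ‖ ^ α) (a : E) {r : ℝ} (hr : 0 < r) :
    μ.real {z | r < |inner ℝ a z|} ≤ 2 * (2 * ‖a‖) ^ α * s * r ^ (-α) := by
  have hle : -2 * r⁻¹ ≤ 2 * r⁻¹ := by linarith [inv_pos.2 hr]
  have hbound : ∀ t ∈ Set.uIoc (-2 * r⁻¹) (2 * r⁻¹),
      ‖1 - charFun μ (t • a)‖ ≤ s * (2 * r⁻¹ * ‖a‖) ^ α := by
    intro t ht
    rw [Set.uIoc_of_le hle] at ht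
    have ht' : ‖t • a‖ ≤ 2 * r⁻¹ * ‖a‖ := by
      rw [norm_smul, Real.norm_eq_abs]
      gcongr
      exact abs_le.2 ⟨by linarith [ht.1], ht.2⟩
    exact (hμ _).trans (by gcongr)
  calc μ.real {z | r < |inner ℝ a z|}
      ≤ 2⁻¹ * r * ‖∫ t in (-2 * r⁻¹)..(2 * r⁻¹), 1 - charFun μ (t • a)‖ :=
        measureReal_abs_inner_gt_le_integral_charFun hr
    _ ≤ 2⁻¹ * r * ((s * (2 * r⁻¹ * ‖a‖) ^ α) * |2 * r⁻¹ - -2 * r⁻¹|) := by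
        gcongr
        exact intervalIntegral.norm_integral_le_of_norm_le_const hbound
    _ = 2 * (2 * ‖a‖) ^ α * s * r ^ (-α) := by
        rw [abs_of_nonneg (by linarith), mul_right_comm 2 r⁻¹, Real.mul_rpow (by positivity)
          (by positivity), Real.inv_rpow hr.le, ← Real.rpow_neg hr.le]
        field_simp
        ring

lemma measure_norm_gt_le_of_norm_one_sub_charFun_le {μ : Measure ℂ} [IsProbabilityMeasure μ]
    {α s : ℝ} (hα : 0 ≤ α) (hs : 0 ≤ s) (hμ : ∀ θ, ‖1 - charFun μ θ‖ ≤ s * ‖θ‖ ^ α)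
    {r : ℝ} (hr : 0 < r) :
    μ {z | r < ‖z‖} ≤ ENNReal.ofReal (4 * 4 ^ α * s * r ^ (-α)) := by
  have hsub : {z : ℂ | r < ‖z‖} ⊆
      {z | r / 2 < |inner ℝ (1 : ℂ) z|} ∪ {z | r / 2 < |inner ℝ Complex.I z|} := by
    intro z hz
    simp only [Complex.inner, Set.mem_union, Set.mem_ofPred_eq, map_one, mul_one, Complex.conj_I,
      mul_neg, Complex.neg_re, Complex.mul_I_re, neg_neg] at hz ⊢
    by_contra! h
    linarith [Complex.norm_le_abs_re_add_abs_im z]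
  have hproj : ∀ a : ℂ, ‖a‖ = 1 →
      μ.real {z | r / 2 < |inner ℝ a z|} ≤ 2 * 4 ^ α * s * r ^ (-α) := by
    intro a ha
    refine (measureReal_abs_inner_gt_le_of_norm_one_sub_charFun_le hα hs hμ a
      (half_pos hr)).trans_eq ?_
    rw [ha, Real.div_rpow hr.le zero_le_two, Real.rpow_neg zero_le_two,
      show (4 : ℝ) = 2 * 2 by norm_num, Real.mul_rpow zero_le_two zero_le_two]
    field_simp
  rw [← ofReal_measureReal]
  refine ENNReal.ofReal_le_ofReal ((measureReal_mono hsub).trans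
    ((measureReal_union_le _ _).trans ?_))
  linarith [hproj 1 norm_one, hproj Complex.I Complex.norm_I]

lemma map_neg_eq_of_charFun_neg [BorelSpace E] [SecondCountableTopology E] [CompleteSpace E]
    {μ : Measure E} [IsFiniteMeasure μ] (hμ : ∀ θ, charFun μ (-θ) = charFun μ θ) :
    μ.map (fun z => -z) = μ := by
  refine Measure.ext_of_charFun (funext fun θ => ?_)
  simpa only [neg_smul, one_smul, hμ] using charFun_map_smul (μ := μ) (-1) θ

end Tails

section HeavyTails

variable {Ω : Type*} [MeasurableSpace Ω] {P : Measure Ω} {β y : ℝ}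

lemma lintegral_min_le_of_tail {X : Ω → ℝ} {B : ℝ≥0∞} (hX : Measurable X) (hX0 : ∀ ω, 0 ≤ X ω)
    (hβ : β < 1) (hy : 0 < y)
    (htail : ∀ u, 0 < u → P {ω | u < X ω} ≤ B * ENNReal.ofReal (u ^ (-β))) :
    ∫⁻ ω, ENNReal.ofReal (min (X ω) y) ∂P ≤ B * ENNReal.ofReal (y ^ (1 - β) / (1 - β)) := by
  have hintegral : IntervalIntegrable (fun u : ℝ => u ^ (-β)) volume 0 y :=
    intervalIntegral.intervalIntegrable_rpow' (by linarith)
  rw [lintegral_eq_lintegral_meas_lt P (ae_of_all _ fun ω => le_min (hX0 ω) hy.le)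
    (hX.min measurable_const).aemeasurable]
  calc ∫⁻ u in Set.Ioi (0 : ℝ), P {ω | u < min (X ω) y}
      ≤ ∫⁻ u in Set.Ioi (0 : ℝ), (Set.Ioc 0 y).indicator
          (fun u => B * ENNReal.ofReal (u ^ (-β))) u := by
        refine setLIntegral_mono' measurableSet_Ioi fun u hu => ?_
        by_cases huy : u ≤ y
        · rw [Set.indicator_of_mem (show u ∈ Set.Ioc 0 y from ⟨hu, huy⟩)]
          exact (measure_mono fun ω (hω : u < min (X ω) y) => (lt_min_iff.1 hω).1).trans
            (htail u hu)
        · simp [(not_le.1 huy).not_gt]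
    _ = B * ∫⁻ u in Set.Ioc (0 : ℝ) y, ENNReal.ofReal (u ^ (-β)) := by
        rw [setLIntegral_indicator measurableSet_Ioc, Set.inter_eq_left.2 fun u hu => hu.1,
          lintegral_const_mul _ (by fun_prop)]
    _ = B * ENNReal.ofReal (∫ u in Set.Ioc (0 : ℝ) y, u ^ (-β)) := by
        rw [ofReal_integral_eq_lintegral_ofReal
          ((intervalIntegrable_iff_integrableOn_Ioc_of_le hy.le).1 hintegral)
          ((ae_restrict_iff' measurableSet_Ioc).2
            (ae_of_all _ fun u hu => Real.rpow_nonneg hu.1.le _))]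
    _ = B * ENNReal.ofReal (y ^ (1 - β) / (1 - β)) := by
        rw [← intervalIntegral.integral_of_le hy.le, integral_rpow (Or.inl (by linarith)),
          neg_add_eq_sub, Real.zero_rpow (by linarith), sub_zero]

/- The union bound handles the event that some summand exceeds `y`; off it the summands are
truncated at `y` and Markov's inequality applies. -/
lemma measure_sum_gt_le_of_tail {ι : Type*} [Fintype ι] {X : ι → Ω → ℝ} {B : ι → ℝ≥0∞}
    (hX : ∀ i, Measurable (X i)) (hX0 : ∀ i ω, 0 ≤ X i ω) (hβ : β < 1) (hy : 0 < y)
    (htail : ∀ i u, 0 < u → P {ω | u < X i ω} ≤ B i * ENNReal.ofReal (u ^ (-β))) :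
    P {ω | y < ∑ i, X i ω} ≤ ENNReal.ofReal ((1 + 1 / (1 - β)) * y ^ (-β)) * ∑ i, B i := by
  have hβ' : 0 < 1 - β := sub_pos.2 hβ
  have hsub : {ω | y < ∑ i, X i ω} ⊆ (⋃ i, {ω | y < X i ω}) ∪
      {ω | ENNReal.ofReal y ≤ ∑ i, ENNReal.ofReal (min (X i ω) y)} := by
    intro ω hω
    by_cases h : ∃ i, y < X i ω
    · exact Or.inl (Set.mem_iUnion.2 h)
    · push Not at h
      refine Or.inr ?_
      simp only [Set.mem_ofPred_eq, min_eq_left (h _)]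
      rw [← ENNReal.ofReal_sum_of_nonneg fun i _ => hX0 i ω]
      exact ENNReal.ofReal_le_ofReal (le_of_lt hω)
  have hlarge : P (⋃ i, {ω | y < X i ω}) ≤ ENNReal.ofReal (y ^ (-β)) * ∑ i, B i := by
    refine (measure_iUnion_fintype_le P _).trans ?_
    rw [Finset.mul_sum]
    exact Finset.sum_le_sum fun i _ => (htail i y hy).trans_eq (mul_comm _ _)
  have hmeas : ∀ i, Measurable fun ω => ENNReal.ofReal (min (X i ω) y) := fun i =>
    ((hX i).min measurable_const).ennreal_ofReal
  have htrunc : P {ω | ENNReal.ofReal y ≤ ∑ i, ENNReal.ofReal (min (X i ω) y)} ≤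
      ENNReal.ofReal (1 / (1 - β) * y ^ (-β)) * ∑ i, B i := by
    refine (meas_ge_le_lintegral_div (Finset.measurable_sum _ fun i _ => hmeas i).aemeasurable
      (ENNReal.ofReal_pos.2 hy).ne' ENNReal.ofReal_ne_top).trans ?_
    rw [lintegral_finsetSum _ fun i _ => hmeas i, ENNReal.div_eq_inv_mul, Finset.mul_sum,
      Finset.mul_sum, ← ENNReal.ofReal_inv_of_pos hy]
    refine Finset.sum_le_sum fun i _ => ?_
    grw [lintegral_min_le_of_tail (hX i) (hX0 i) hβ hy (htail i)]
    rw [mul_left_comm, mul_comm, ← ENNReal.ofReal_mul (inv_nonneg.2 hy.le), sub_eq_add_neg 1 β,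
      Real.rpow_add hy, Real.rpow_one]
    apply le_of_eq
    congr 2
    field_simp
  refine (measure_mono hsub).trans ((measure_union_le _ _).trans
    ((add_le_add hlarge htrunc).trans_eq ?_))
  rw [← add_mul, ← ENNReal.ofReal_add (by positivity) (by positivity), ← one_add_mul]

end HeavyTails

section SelfNormalized

variable {Ω ι : Type*} [MeasurableSpace Ω] {P : Measure Ω} [IsProbabilityMeasure P] [Fintype ι]

/- Averaging over the two signs gives `cosh x * exp (-x² / 2) ≤ 1`. -/
lemma lintegral_exp_sub_sq_half_le_one {X : Ω → ℝ} (hX : IdentDistrib (fun ω => -X ω) X P P) :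
    ∫⁻ ω, ENNReal.ofReal (Real.exp (X ω - X ω ^ 2 / 2)) ∂P ≤ 1 := by
  let φ : ℝ → ℝ≥0∞ := fun x => ENNReal.ofReal (Real.exp (x - x ^ 2 / 2))
  have hφ : Measurable φ := by fun_prop
  have hsymm : ∫⁻ ω, φ (-X ω) ∂P = ∫⁻ ω, φ (X ω) ∂P := (hX.comp hφ).lintegral_eq
  have hpair : ∀ x, φ x + φ (-x) ≤ 2 := by
    intro x
    have hcosh : Real.exp (x - x ^ 2 / 2) + Real.exp (-x - (-x) ^ 2 / 2) ≤ 2 := by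
      have h := mul_le_mul_of_nonneg_right (Real.cosh_le_exp_half_sq x)
        (Real.exp_nonneg (-(x ^ 2 / 2)))
      rw [← Real.exp_add, add_neg_cancel, Real.exp_zero, Real.cosh_eq] at h
      rw [neg_sq, sub_eq_add_neg, sub_eq_add_neg, Real.exp_add, Real.exp_add]
      linarith
    rw [← ENNReal.ofReal_add (Real.exp_nonneg _) (Real.exp_nonneg _)]
    exact ENNReal.ofReal_le_of_le_toReal hcosh
  have hsum : 2 * ∫⁻ ω, φ (X ω) ∂P ≤ 2 * 1 :=
    calc 2 * ∫⁻ ω, φ (X ω) ∂P = ∫⁻ ω, (φ (X ω) + φ (-X ω)) ∂P := by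
          rw [lintegral_add_left' (f := fun ω => φ (X ω))
            (hφ.comp_aemeasurable hX.aemeasurable_snd), hsymm, two_mul]
      _ ≤ ∫⁻ _, 2 ∂P := lintegral_mono fun ω => hpair (X ω)
      _ = 2 * 1 := by simp
  exact (ENNReal.mul_le_mul_iff_right two_ne_zero ENNReal.ofNat_ne_top).1 hsum

lemma lintegral_exp_sum_sub_sum_sq_half_le_one {X : ι → Ω → ℝ} (hindep : iIndepFun X P)
    (hm : ∀ i, Measurable (X i)) (hX : ∀ i, IdentDistrib (fun ω => -X i ω) (X i) P P) :
    ∫⁻ ω, ENNReal.ofReal (Real.exp (∑ i, X i ω - (∑ i, X i ω ^ 2) / 2)) ∂P ≤ 1 := by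
  let φ : ℝ → ℝ≥0∞ := fun x => ENNReal.ofReal (Real.exp (x - x ^ 2 / 2))
  have hφ : Measurable φ := by fun_prop
  have hprod : ∀ ω, ENNReal.ofReal (Real.exp (∑ i, X i ω - (∑ i, X i ω ^ 2) / 2)) =
      ∏ i, φ (X i ω) := by
    intro ω
    rw [Finset.sum_div, ← Finset.sum_sub_distrib, Real.exp_sum,
      ENNReal.ofReal_prod_of_nonneg fun i _ => Real.exp_nonneg _]
  simp_rw [hprod]
  rw [lintegral_prod_eq_prod_lintegral_of_indepFun Finset.univ (fun i ω => φ (X i ω))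
    (hindep.comp (fun _ => φ) fun _ => hφ) fun i => hφ.comp (hm i)]
  exact Finset.prod_le_one' fun i _ => lintegral_exp_sub_sq_half_le_one (hX i)

lemma measure_sum_gt_and_sum_sq_le {X : ι → Ω → ℝ} (hindep : iIndepFun X P)
    (hm : ∀ i, Measurable (X i)) (hX : ∀ i, IdentDistrib (fun ω => -X i ω) (X i) P P)
    {t y : ℝ} (ht : 0 ≤ t) (hy : 0 < y) :
    P {ω | t < ∑ i, X i ω ∧ ∑ i, X i ω ^ 2 ≤ y} ≤
      ENNReal.ofReal (Real.exp (-(t ^ 2 / (2 * y)))) := by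
  let c := t / y
  have hintegral : ∫⁻ ω, ENNReal.ofReal (Real.exp (∑ i, c * X i ω - (∑ i, (c * X i ω) ^ 2) / 2)) ∂P
      ≤ 1 := by
    refine lintegral_exp_sum_sub_sum_sq_half_le_one
      (hindep.comp (fun _ x => c * x) fun _ => measurable_const_mul c)
      (fun i => (hm i).const_mul c) fun i => ?_
    simpa only [Function.comp_def, mul_neg] using (hX i).comp (measurable_const_mul c)
  have hsub : {ω | t < ∑ i, X i ω ∧ ∑ i, X i ω ^ 2 ≤ y} ⊆
      {ω | ENNReal.ofReal (Real.exp (t ^ 2 / (2 * y))) ≤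
        ENNReal.ofReal (Real.exp (∑ i, c * X i ω - (∑ i, (c * X i ω) ^ 2) / 2))} := by
    rintro ω ⟨hlt, hle⟩
    refine ENNReal.ofReal_le_ofReal (Real.exp_le_exp.2 ?_)
    simp_rw [mul_pow, ← Finset.mul_sum]
    have hc : 0 ≤ c := by positivity
    calc t ^ 2 / (2 * y) = c * t - c ^ 2 * y / 2 := by simp only [c]; field_simp; ring
      _ ≤ _ := by gcongr
  refine (measure_mono hsub).trans ((meas_ge_le_lintegral_div (by fun_prop)
    (ENNReal.ofReal_pos.2 (Real.exp_pos _)).ne' ENNReal.ofReal_ne_top).trans ?_)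
  grw [hintegral]
  rw [one_div, ← ENNReal.ofReal_inv_of_pos (Real.exp_pos _), Real.exp_neg]

lemma measure_abs_sum_gt_and_sum_sq_le {X : ι → Ω → ℝ} (hindep : iIndepFun X P)
    (hm : ∀ i, Measurable (X i)) (hX : ∀ i, IdentDistrib (fun ω => -X i ω) (X i) P P)
    {t y : ℝ} (ht : 0 ≤ t) (hy : 0 < y) :
    P {ω | t < |∑ i, X i ω| ∧ ∑ i, X i ω ^ 2 ≤ y} ≤
      2 * ENNReal.ofReal (Real.exp (-(t ^ 2 / (2 * y)))) := by
  have hneg := measure_sum_gt_and_sum_sq_le (X := fun i ω => -X i ω)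
    (hindep.comp (fun _ x => -x) fun _ => measurable_neg) (fun i => (hm i).neg)
    (fun i => (hX i).comp measurable_neg) ht hy
  simp only [Finset.sum_neg_distrib, neg_sq] at hneg
  rw [two_mul]
  refine (measure_mono fun ω hω => ?_).trans ((measure_union_le _ _).trans
    (add_le_add (measure_sum_gt_and_sum_sq_le hindep hm hX ht hy) hneg))
  exact (lt_abs.1 hω.1).imp (fun h => ⟨h, hω.2⟩) (fun h => ⟨h, hω.2⟩)

lemma measure_norm_sum_gt_and_sum_sq_le {X : ι → Ω → ℂ} (hindep : iIndepFun X P)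
    (hm : ∀ i, Measurable (X i)) (hX : ∀ i, IdentDistrib (fun ω => -X i ω) (X i) P P)
    {t y : ℝ} (ht : 0 ≤ t) (hy : 0 < y) :
    P {ω | t < ‖∑ i, X i ω‖ ∧ ∑ i, ‖X i ω‖ ^ 2 ≤ y} ≤
      4 * ENNReal.ofReal (Real.exp (-(t ^ 2 / (8 * y)))) := by
  have hre := measure_abs_sum_gt_and_sum_sq_le
    (hindep.comp (fun _ z => z.re) fun _ => Complex.measurable_re)
    (fun i => Complex.measurable_re.comp (hm i)) (fun i => (hX i).comp Complex.measurable_re)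
    (div_nonneg ht zero_le_two) hy
  have him := measure_abs_sum_gt_and_sum_sq_le
    (hindep.comp (fun _ z => z.im) fun _ => Complex.measurable_im)
    (fun i => Complex.measurable_im.comp (hm i)) (fun i => (hX i).comp Complex.measurable_im)
    (div_nonneg ht zero_le_two) hy
  simp only [Function.comp_def, ← Complex.re_sum, ← Complex.im_sum,
    show (t / 2) ^ 2 / (2 * y) = t ^ 2 / (8 * y) by ring] at hre him
  rw [show (4 : ℝ≥0∞) = 2 + 2 by norm_num, add_mul]
  refine (measure_mono fun ω hω => ?_).trans ((measure_union_le _ _).trans (add_le_add hre him))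
  have hre_le : ∑ i, (X i ω).re ^ 2 ≤ y := hω.2.trans' <| Finset.sum_le_sum fun i _ =>
    sq_le_sq.2 (by simpa using Complex.abs_re_le_norm (X i ω))
  have him_le : ∑ i, (X i ω).im ^ 2 ≤ y := hω.2.trans' <| Finset.sum_le_sum fun i _ =>
    sq_le_sq.2 (by simpa using Complex.abs_im_le_norm (X i ω))
  by_contra! h
  simp only [Set.mem_union, Set.mem_ofPred_eq, hre_le, him_le, and_true, not_or, not_lt] at h
  linarith [Complex.norm_le_abs_re_add_abs_im (∑ i, X i ω), hω.1]

end SelfNormalized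

namespace IsStableRandomMeasure

variable {N : ℕ} {Ω : Type*} [MeasurableSpace Ω] {α : ℝ} {P : Measure Ω}
  {M : Set (Fin N → ℝ) → Ω → ℂ}

lemma measure_norm_gt_le [IsProbabilityMeasure P] (hM : IsStableRandomMeasure α P M) (hα : 0 ≤ α)
    {A : Set (Fin N → ℝ)} (hA : MeasurableSet A) (hAv : volume A < ∞) {r : ℝ} (hr : 0 < r) :
    P {ω | r < ‖M A ω‖} ≤ ENNReal.ofReal (4 * 4 ^ α * r ^ (-α)) * volume A := by
  have hm := hM.measurable A hA hAv
  have : IsProbabilityMeasure (P.map (M A)) := Measure.isProbabilityMeasure_map hm.aemeasurable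
  have hchar : ∀ θ, ‖1 - charFun (P.map (M A)) θ‖ ≤ volume.real A * ‖θ‖ ^ α := by
    intro θ
    have h0 : 0 ≤ ‖θ‖ ^ α * volume.real A := by positivity
    rw [hM.charFun_eq A hA hAv, ← Complex.ofReal_one, ← Complex.ofReal_sub, Complex.norm_real,
      Real.norm_of_nonneg (by simpa using h0)]
    linarith [Real.one_sub_le_exp_neg (‖θ‖ ^ α * volume.real A)]
  have h := measure_norm_gt_le_of_norm_one_sub_charFun_le hα measureReal_nonneg hchar hr
  rwa [Measure.map_apply hm (measurableSet_lt measurable_const measurable_norm), mul_right_comm,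
    ENNReal.ofReal_mul (by positivity), ofReal_measureReal hAv.ne] at h

lemma measure_mul_norm_rpow_gt_le [IsProbabilityMeasure P] (hM : IsStableRandomMeasure α P M)
    (hα : 0 < α) {A : Set (Fin N → ℝ)} (hA : MeasurableSet A) (hAv : volume A < ∞) {p : ℝ}
    (hp : 0 < p) {E : Type*} [SeminormedAddCommGroup E] (c : E) {u : ℝ} (hu : 0 < u) :
    P {ω | u < (‖c‖ * ‖M A ω‖) ^ p} ≤
      ENNReal.ofReal (4 * 4 ^ α) * (‖c‖ₑ ^ α * volume A) * ENNReal.ofReal (u ^ (-(α / p))) := by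
  rcases (norm_nonneg c).eq_or_lt with hc | hc
  · simp [← hc, Real.zero_rpow hp.ne', hu.not_gt]
  have hset : {ω | u < (‖c‖ * ‖M A ω‖) ^ p} = {ω | u ^ p⁻¹ / ‖c‖ < ‖M A ω‖} := by
    ext ω
    simp only [Set.mem_ofPred_eq]
    rw [div_lt_iff₀' hc, Real.rpow_inv_lt_iff_of_pos hu.le (by positivity) hp]
  have hpow : (u ^ p⁻¹ / ‖c‖) ^ (-α) = ‖c‖ ^ α * u ^ (-(α / p)) := by
    rw [Real.div_rpow (by positivity) hc.le, ← Real.rpow_mul hu.le, Real.rpow_neg hc.le,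
      show p⁻¹ * -α = -(α / p) by ring, div_inv_eq_mul, mul_comm]
  rw [hset]
  refine (hM.measure_norm_gt_le hα.le hA hAv (by positivity)).trans_eq ?_
  rw [hpow, ENNReal.ofReal_mul (by positivity), ENNReal.ofReal_mul (p := ‖c‖ ^ α) (by positivity),
    ← ENNReal.ofReal_rpow_of_nonneg (norm_nonneg c) hα.le, ofReal_norm]
  ring

lemma identDistrib_neg [IsFiniteMeasure P] (hM : IsStableRandomMeasure α P M)
    {A : Set (Fin N → ℝ)} (hA : MeasurableSet A) (hAv : volume A < ∞) :
    IdentDistrib (fun ω => -M A ω) (M A) P P := by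
  have hm := hM.measurable A hA hAv
  refine ⟨hm.neg.aemeasurable, hm.aemeasurable, ?_⟩
  have h := map_neg_eq_of_charFun_neg (μ := P.map (M A)) fun θ => by
    rw [hM.charFun_eq A hA hAv, hM.charFun_eq A hA hAv, norm_neg]
  rwa [Measure.map_map measurable_neg hm] at h

lemma iIndepFun_of_pairwise_disjoint (hM : IsStableRandomMeasure α P M) {ι : Type*} [Finite ι]
    {A : ι → Set (Fin N → ℝ)} (hA : ∀ i, MeasurableSet (A i)) (hAv : ∀ i, volume (A i) < ∞)
    (hd : Pairwise (Function.onFun Disjoint A)) : iIndepFun (fun i => M (A i)) P :=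
  let e := (Finite.equivFin ι).symm
  (hM.indep _ (fun i => A (e i)) (fun _ => hA _) (fun _ => hAv _)
    fun _ _ h => hd (e.injective.ne h)).of_precomp e.surjective

lemma ae_empty_eq_zero (hM : IsStableRandomMeasure α P M) : ∀ᵐ ω ∂P, M ∅ ω = 0 := by
  filter_upwards [hM.sigma_additive (fun _ => ∅) (fun _ => MeasurableSet.empty) (by simp)
    fun _ _ _ => disjoint_bot_left] with ω hω
  simp only [Finset.sum_const, Finset.card_range, Set.iUnion_empty] at hω
  have hdiff := (hω.comp (tendsto_add_atTop_nat 1)).sub hω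
  simp only [Function.comp_def, add_smul, one_smul, add_sub_cancel_left, sub_self] at hdiff
  exact tendsto_nhds_unique tendsto_const_nhds hdiff

lemma ae_biUnion_finset_eq (hM : IsStableRandomMeasure α P M) {ι : Type*} (s : Finset ι)
    {A : ι → Set (Fin N → ℝ)} (hA : ∀ i ∈ s, MeasurableSet (A i))
    (hAv : ∀ i ∈ s, volume (A i) < ∞) (hd : (s : Set ι).PairwiseDisjoint A) :
    ∀ᵐ ω ∂P, M (⋃ i ∈ s, A i) ω = ∑ i ∈ s, M (A i) ω := by
  classical
  let A' : s → Set (Fin N → ℝ) := fun i => A i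
  have hcod : Encodable s := Fintype.toEncodable s
  let B : ℕ → Set (Fin N → ℝ) := fun n => ⋃ i ∈ Encodable.decode₂ s n, A' i
  have hUnion : ⋃ n, B n = ⋃ i ∈ s, A i := by
    rw [Encodable.iUnion_decode₂]
    exact iSup_subtype (f := fun i : s => A i)
  have hadd := hM.sigma_additive B
    (fun _ => Encodable.iUnion_decode₂_cases (C := MeasurableSet) (f := A') .empty
      fun i => hA i i.2)
    (hUnion ▸ (measure_biUnion_finset_le s A).trans_lt (ENNReal.sum_lt_top.2 hAv))
    (Encodable.iUnion_decode₂_disjoint_on fun i j hij => hd i.2 j.2 (Subtype.coe_ne_coe.2 hij))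
  rw [hUnion] at hadd
  filter_upwards [hadd, hM.ae_empty_eq_zero] with ω hω h0
  have hfin : Function.HasFiniteSupport fun n => M (B n) ω := by
    refine (Set.finite_range (Encodable.encode : s → ℕ)).subset fun n hn => ?_
    by_contra hmem
    have hnone : Encodable.decode₂ s n = none :=
      Option.eq_none_iff_forall_not_mem.2 fun i hi => hmem ⟨i, Encodable.mem_decode₂.1 hi⟩
    exact hn (by simp [B, hnone, h0])
  calc M (⋃ i ∈ s, A i) ω = ∑' n, M (B n) ω :=
        tendsto_nhds_unique hω (summable_of_hasFiniteSupport hfin).hasSum.tendsto_sum_nat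
    _ = ∑' i, M (A' i) ω := tsum_iUnion_decode₂ (fun U => M U ω) h0 A'
    _ = ∑ i ∈ s, M (A i) ω := by rw [tsum_fintype, Finset.sum_coe_sort s fun i => M (A i) ω]

end IsStableRandomMeasure

/-- The constant in the tail `y ^ (-(α / p))` of sums of `p`-th powers of the values of an
`α`-stable random measure: `4 * 4 ^ α` bounds the tail of a single value, and the other factor is
the price of summation. -/
noncomputable def tailConst (α p : ℝ) : ℝ := 4 * 4 ^ α * (1 + 1 / (1 - α / p))

namespace IsStableRandomMeasure

variable {N : ℕ} {Ω : Type*} [MeasurableSpace Ω] {α : ℝ} {P : Measure Ω} [IsProbabilityMeasure P]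
  {M : Set (Fin N → ℝ) → Ω → ℂ} {ι κ : Type*} [Fintype ι] [Fintype κ]
  {A : ι → Set (Fin N → ℝ)}

lemma measure_sum_mul_norm_rpow_gt_le (hM : IsStableRandomMeasure α P M) (hα : 0 < α) {p : ℝ}
    (hp : α < p) (hA : ∀ i, MeasurableSet (A i)) (hAv : ∀ i, volume (A i) < ∞)
    {E : Type*} [SeminormedAddCommGroup E] (c : ι → E) {y : ℝ} (hy : 0 < y) :
    P {ω | y < ∑ i, (‖c i‖ * ‖M (A i) ω‖) ^ p} ≤
      ENNReal.ofReal (tailConst α p * y ^ (-(α / p))) * ∑ i, ‖c i‖ₑ ^ α * volume (A i) := by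
  have hp0 : 0 < p := hα.trans hp
  have hm := fun i => hM.measurable (A i) (hA i) (hAv i)
  refine (measure_sum_gt_le_of_tail (fun i => ((hm i).norm.const_mul _).pow_const _)
    (fun i ω => by positivity) ((div_lt_one hp0).2 hp) hy fun i u hu =>
      hM.measure_mul_norm_rpow_gt_le hα (hA i) (hAv i) hp0 (c i) hu).trans_eq ?_
  rw [← Finset.mul_sum, ← mul_assoc, ← ENNReal.ofReal_mul' (by positivity), tailConst]
  congr 2
  ring

lemma measure_exists_norm_sum_gt_le_of_lt_one (hM : IsStableRandomMeasure α P M) (hα : 0 < α)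
    (hα1 : α < 1) (hA : ∀ i, MeasurableSet (A i)) (hAv : ∀ i, volume (A i) < ∞)
    (c : ι → κ → ℂ) {t : ℝ} (ht : 0 < t) :
    P {ω | ∃ k, t < ‖∑ i, c i k * M (A i) ω‖} ≤
      ENNReal.ofReal (tailConst α 1 * t ^ (-α)) * ∑ i, ‖c i‖ₑ ^ α * volume (A i) := by
  have h := hM.measure_sum_mul_norm_rpow_gt_le hα hα1 hA hAv c ht
  simp only [div_one, Real.rpow_one] at h
  refine (measure_mono ?_).trans h
  rintro ω ⟨k, hk⟩
  refine hk.trans_le (norm_sum_le_of_le _ fun i _ => ?_)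
  rw [norm_mul]
  gcongr
  exact norm_le_pi_norm (c i) k

lemma measure_norm_sum_gt_and_sum_sq_le (hM : IsStableRandomMeasure α P M)
    (hA : ∀ i, MeasurableSet (A i)) (hAv : ∀ i, volume (A i) < ∞)
    (hd : Pairwise (Function.onFun Disjoint A)) (c : ι → ℂ) {t y : ℝ} (ht : 0 ≤ t) (hy : 0 < y) :
    P {ω | t < ‖∑ i, c i * M (A i) ω‖ ∧ ∑ i, ‖c i * M (A i) ω‖ ^ 2 ≤ y} ≤
      4 * ENNReal.ofReal (Real.exp (-(t ^ 2 / (8 * y)))) := by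
  refine HFSS.measure_norm_sum_gt_and_sum_sq_le
    ((hM.iIndepFun_of_pairwise_disjoint hA hAv hd).comp (fun i z => c i * z) fun i =>
      measurable_const_mul (c i))
    (fun i => (hM.measurable _ (hA i) (hAv i)).const_mul (c i)) (fun i => ?_) ht hy
  simpa only [Function.comp_def, mul_neg] using
    (hM.identDistrib_neg (hA i) (hAv i)).comp (measurable_const_mul (c i))

lemma measure_exists_norm_sum_gt_le_of_lt_two (hM : IsStableRandomMeasure α P M) (hα : 0 < α)
    (hα2 : α < 2) (hA : ∀ i, MeasurableSet (A i)) (hAv : ∀ i, volume (A i) < ∞)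
    (hd : Pairwise (Function.onFun Disjoint A)) (c : ι → κ → ℂ) {t : κ → ℝ} (ht : ∀ k, 0 ≤ t k)
    {y : ℝ} (hy : 0 < y) :
    P {ω | ∃ k, t k < ‖∑ i, c i k * M (A i) ω‖} ≤
      ENNReal.ofReal (tailConst α 2 * y ^ (-(α / 2))) * ∑ i, ‖c i‖ₑ ^ α * volume (A i) +
        ∑ k, 4 * ENNReal.ofReal (Real.exp (-(t k ^ 2 / (8 * y)))) := by
  have hvar := hM.measure_sum_mul_norm_rpow_gt_le hα hα2 hA hAv c hy
  have hdev : P (⋃ k, {ω | t k < ‖∑ i, c i k * M (A i) ω‖ ∧ ∑ i, ‖c i k * M (A i) ω‖ ^ 2 ≤ y}) ≤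
      ∑ k, 4 * ENNReal.ofReal (Real.exp (-(t k ^ 2 / (8 * y)))) :=
    (measure_iUnion_fintype_le P _).trans (Finset.sum_le_sum fun k _ =>
      hM.measure_norm_sum_gt_and_sum_sq_le hA hAv hd (fun i => c i k) (ht k) hy)
  refine (measure_mono ?_).trans ((measure_union_le _ _).trans (add_le_add hvar hdev))
  rintro ω ⟨k, hk⟩
  refine (lt_or_ge y _).imp_right fun hle => Set.mem_iUnion.2 ⟨k, hk, hle.trans' ?_⟩
  refine Finset.sum_le_sum fun i _ => ?_
  rw [Real.rpow_two, norm_mul]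
  gcongr
  exact norm_le_pi_norm (c i) k

end IsStableRandomMeasure

section SimpleFunc

variable {X E : Type*} [MeasurableSpace X] [NormedAddCommGroup E]

open scoped Classical in
/-- The nonzero values of a simple function `G`. They index the level sets `G ⁻¹' {v}`, which are
disjoint and, when `G` is supported on a set of finite measure, have finite measure. -/
noncomputable def nonzeroRange (G : SimpleFunc X E) : Finset E := {v ∈ G.range | v ≠ 0}

lemma mem_nonzeroRange {G : SimpleFunc X E} {v : E} :
    v ∈ nonzeroRange G ↔ v ∈ G.range ∧ v ≠ 0 := by
  simp only [nonzeroRange, Finset.mem_filter]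

lemma lintegral_enorm_rpow_eq_sum_nonzeroRange (μ : Measure X) (G : SimpleFunc X E) {α : ℝ}
    (hα : 0 < α) :
    ∫⁻ x, ‖G x‖ₑ ^ α ∂μ = ∑ v : nonzeroRange G, ‖(v : E)‖ₑ ^ α * μ (G ⁻¹' {(v : E)}) := by
  have hrange : ∫⁻ x, ‖G x‖ₑ ^ α ∂μ = ∑ v ∈ G.range, ‖v‖ₑ ^ α * μ (G ⁻¹' {v}) := by
    rw [← SimpleFunc.map_lintegral (fun v => ‖v‖ₑ ^ α), ← SimpleFunc.lintegral_eq_lintegral]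
    rfl
  rw [hrange, Finset.sum_coe_sort (nonzeroRange G) fun v => ‖v‖ₑ ^ α * μ (G ⁻¹' {v})]
  refine (Finset.sum_subset (fun v hv => (mem_nonzeroRange.1 hv).1) fun v hv hv' => ?_).symm
  have hv0 : v = 0 := by
    by_contra h
    exact hv' (mem_nonzeroRange.2 ⟨hv, h⟩)
  simp [hv0, hα]

variable {κ : Type*} [Finite κ]

/-- Finitely many simple functions, gathered into one simple function with values in a product. -/
def simplePi (g : κ → SimpleFunc X E) : SimpleFunc X (κ → E) where
  toFun x k := g k x
  measurableSet_fiber' v := by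
    have hfiber : (fun x k => g k x) ⁻¹' {v} = ⋂ k, g k ⁻¹' {v k} := by
      ext x
      simp [funext_iff]
    rw [hfiber]
    exact MeasurableSet.iInter fun k => (g k).measurableSet_fiber _
  finite_range' := (Set.Finite.pi' fun k => (g k).finite_range).subset <| by
    rintro _ ⟨x, rfl⟩ k
    exact ⟨x, rfl⟩

lemma finMeasSupp_simplePi {μ : Measure X} {g : κ → SimpleFunc X E}
    (hg : ∀ k, (g k).FinMeasSupp μ) : (simplePi g).FinMeasSupp μ := by
  refine SimpleFunc.finMeasSupp_iff.2 fun v hv => ?_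
  obtain ⟨k, hk⟩ := Function.ne_iff.1 hv
  exact (measure_mono fun x hx => congrFun hx k).trans_lt
    ((hg k).meas_preimage_singleton_ne_zero hk)

end SimpleFunc

section LpDistance

variable {E : Type*} [NormedAddCommGroup E] {α : ℝ}

lemma enorm_pi_rpow_le_of_forall {κ : Type*} [Fintype κ] (hα : 0 < α) {u : κ → E} {D : ℝ≥0∞}
    (h : ∀ k, ‖u k‖ₑ ^ α ≤ D) : ‖u‖ₑ ^ α ≤ D := by
  rcases isEmpty_or_nonempty κ with hκ | hκ
  · simp [Subsingleton.elim u 0, hα]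
  · obtain ⟨k, -, hk⟩ := Finset.exists_mem_eq_sup Finset.univ Finset.univ_nonempty fun k => ‖u k‖₊
    rw [enorm_eq_nnnorm, Pi.nnnorm_def, hk]
    exact h k

lemma enorm_rpow_le_two_rpow_mul (hα : 0 ≤ α) (u v : E) :
    ‖u‖ₑ ^ α ≤ 2 ^ α * (‖v‖ₑ ^ α + ‖u - v‖ₑ ^ α) :=
  calc ‖u‖ₑ ^ α ≤ (2 * max ‖v‖ₑ ‖u - v‖ₑ) ^ α := by
        gcongr
        calc ‖u‖ₑ = ‖v + (u - v)‖ₑ := by rw [add_sub_cancel]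
          _ ≤ ‖v‖ₑ + ‖u - v‖ₑ := enorm_add_le _ _
          _ ≤ 2 * max ‖v‖ₑ ‖u - v‖ₑ := by
            rw [two_mul]
            exact add_le_add (le_max_left _ _) (le_max_right _ _)
    _ = 2 ^ α * max (‖v‖ₑ ^ α) (‖u - v‖ₑ ^ α) := by
        rw [ENNReal.mul_rpow_of_nonneg _ _ hα, (ENNReal.monotone_rpow_of_nonneg hα).map_max]
    _ ≤ 2 ^ α * (‖v‖ₑ ^ α + ‖u - v‖ₑ ^ α) := by gcongr; exact max_le_add_of_nonneg zero_le zero_le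

lemma enorm_pi_rpow_le_iSup_add_sum {κ : Type*} [Fintype κ] (hα : 0 < α) (u v : κ → E) :
    ‖u‖ₑ ^ α ≤ 2 ^ α * ((⨆ k, ‖v k‖ₑ ^ α) + ∑ k, ‖u k - v k‖ₑ ^ α) :=
  enorm_pi_rpow_le_of_forall hα fun k => (enorm_rpow_le_two_rpow_mul hα.le (u k) (v k)).trans <| by
    gcongr
    · exact le_iSup (fun k => ‖v k‖ₑ ^ α) k
    · exact Finset.single_le_sum (f := fun k => ‖u k - v k‖ₑ ^ α) (fun _ _ => zero_le)
        (Finset.mem_univ k)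

lemma tendsto_lintegral_enorm_rpow_of_tendsto_eLpNorm {X : Type*} [MeasurableSpace X]
    {μ : Measure X} (hα : 0 < α) {h : ℕ → X → E}
    (hh : Tendsto (fun n => eLpNorm (h n) (ENNReal.ofReal α) μ) atTop (𝓝 0)) :
    Tendsto (fun n => ∫⁻ x, ‖h n x‖ₑ ^ α ∂μ) atTop (𝓝 0) := by
  have hpow := hh.ennrpow_const α
  rw [ENNReal.zero_rpow_of_pos hα] at hpow
  refine hpow.congr fun n => ?_
  rw [eLpNorm_eq_lintegral_rpow_enorm_toReal (ENNReal.ofReal_pos.2 hα).ne' ENNReal.ofReal_ne_top,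
    ENNReal.toReal_ofReal hα.le, ← ENNReal.rpow_mul, one_div_mul_cancel hα.ne', ENNReal.rpow_one]

end LpDistance

section StableIntegral

variable {N : ℕ} {Ω : Type*} [MeasurableSpace Ω] {α : ℝ} {P : Measure Ω}
  {M : Set (Fin N → ℝ) → Ω → ℂ} {κ : Type*}

lemma IsStableRandomMeasure.ae_simpleIntegral_map_eq (hM : IsStableRandomMeasure α P M)
    {E : Type*} [NormedAddCommGroup E] {G : SimpleFunc (Fin N → ℝ) E}
    (hG : G.FinMeasSupp volume) {h : E → ℂ} (h0 : h 0 = 0) :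
    ∀ᵐ ω ∂P, simpleIntegral M (G.map h) ω =
      ∑ v : nonzeroRange G, h v * M (G ⁻¹' {(v : E)}) ω := by
  classical
  let fiber (z : ℂ) : Finset E := {v ∈ nonzeroRange G | h v = z}
  have hadd : ∀ᵐ ω ∂P, ∀ z ∈ (G.map h).range, z * M (G.map h ⁻¹' {z}) ω =
      ∑ v ∈ fiber z, h v * M (G ⁻¹' {v}) ω := by
    refine (Finset.eventually_all _).2 fun z _ => ?_
    rcases eq_or_ne z 0 with rfl | hz
    · refine ae_of_all _ fun ω => ?_
      rw [zero_mul, Finset.sum_eq_zero]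
      intro v hv
      rw [(Finset.mem_filter.1 hv).2, zero_mul]
    have hfiber : G.map h ⁻¹' {z} = ⋃ v ∈ fiber z, G ⁻¹' {v} := by
      ext x
      simp only [SimpleFunc.coe_map, Set.mem_preimage, Function.comp_apply, Set.mem_singleton_iff,
        Set.mem_iUnion, exists_prop, exists_eq_right', fiber, Finset.mem_filter, mem_nonzeroRange]
      refine ⟨fun hx => ⟨⟨G.mem_range_self x, ?_⟩, hx⟩, And.right⟩
      exact fun hG0 => hz (by rw [← hx, hG0, h0])
    filter_upwards [hM.ae_biUnion_finset_eq (fiber z) (fun v _ => G.measurableSet_fiber v)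
      (fun v hv => hG.meas_preimage_singleton_ne_zero
        (mem_nonzeroRange.1 (Finset.mem_filter.1 hv).1).2)
      (Set.pairwiseDisjoint_fiber G _)] with ω hω
    rw [hfiber, hω, Finset.mul_sum]
    exact Finset.sum_congr rfl fun v hv => by rw [(Finset.mem_filter.1 hv).2]
  filter_upwards [hadd] with ω hω
  rw [simpleIntegral, Finset.sum_congr rfl hω, Finset.sum_fiberwise_of_maps_to fun v hv => ?_,
    Finset.sum_coe_sort (nonzeroRange G) fun v => h v * M (G ⁻¹' {v}) ω]
  rw [SimpleFunc.range_map]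
  exact Finset.mem_image_of_mem h (mem_nonzeroRange.1 hv).1

lemma IsStableRandomMeasure.measure_exists_simpleIntegral_gt_le_of_lt_one
    [IsProbabilityMeasure P] (hM : IsStableRandomMeasure α P M) (hα : 0 < α) (hα1 : α < 1)
    [Fintype κ] {G : SimpleFunc (Fin N → ℝ) (κ → ℂ)} (hG : G.FinMeasSupp volume)
    {t : ℝ} (ht : 0 < t) :
    P {ω | ∃ k, t < ‖simpleIntegral M (G.map (· k)) ω‖} ≤
      ENNReal.ofReal (tailConst α 1 * t ^ (-α)) * ∫⁻ x, ‖G x‖ₑ ^ α := by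
  rw [lintegral_enorm_rpow_eq_sum_nonzeroRange volume G hα]
  have hsum := hM.measure_exists_norm_sum_gt_le_of_lt_one
    (κ := κ) (A := fun v : nonzeroRange G => G ⁻¹' {(v : κ → ℂ)}) hα hα1
    (fun v => G.measurableSet_fiber v)
    (fun v => hG.meas_preimage_singleton_ne_zero (mem_nonzeroRange.1 v.2).2)
    (fun v => (v : κ → ℂ)) ht
  refine (measure_mono_ae ?_).trans hsum
  filter_upwards [ae_all_iff.2 fun k => hM.ae_simpleIntegral_map_eq hG (h := (· k)) rfl]
    with ω hω ⟨k, hk⟩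
  exact ⟨k, by rwa [← hω k]⟩

lemma IsStableRandomMeasure.measure_exists_simpleIntegral_gt_le_of_lt_two
    [IsProbabilityMeasure P] (hM : IsStableRandomMeasure α P M) (hα : 0 < α) (hα2 : α < 2)
    [Fintype κ] {G : SimpleFunc (Fin N → ℝ) (κ → ℂ)} (hG : G.FinMeasSupp volume)
    {t : κ → ℝ} (ht : ∀ k, 0 ≤ t k) {y : ℝ} (hy : 0 < y) :
    P {ω | ∃ k, t k < ‖simpleIntegral M (G.map (· k)) ω‖} ≤
      ENNReal.ofReal (tailConst α 2 * y ^ (-(α / 2))) * (∫⁻ x, ‖G x‖ₑ ^ α) +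
        ∑ k, 4 * ENNReal.ofReal (Real.exp (-(t k ^ 2 / (8 * y)))) := by
  rw [lintegral_enorm_rpow_eq_sum_nonzeroRange volume G hα]
  have hsum := hM.measure_exists_norm_sum_gt_le_of_lt_two
    (κ := κ) (A := fun v : nonzeroRange G => G ⁻¹' {(v : κ → ℂ)}) hα hα2
    (fun v => G.measurableSet_fiber v)
    (fun v => hG.meas_preimage_singleton_ne_zero (mem_nonzeroRange.1 v.2).2)
    ((pairwise_disjoint_fiber G).comp_of_injective Subtype.val_injective)
    (fun v => (v : κ → ℂ)) ht hy
  refine (measure_mono_ae ?_).trans hsum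
  filter_upwards [ae_all_iff.2 fun k => hM.ae_simpleIntegral_map_eq hG (h := (· k)) rfl]
    with ω hω ⟨k, hk⟩
  exact ⟨k, by rwa [← hω k]⟩

lemma setOf_exists_two_mul_lt_norm_subset {Ω κ : Type*} {I J : κ → Ω → ℂ} (t : κ → ℝ) :
    {ω | ∃ k, 2 * t k < ‖I k ω‖} ⊆
      {ω | ∃ k, t k < ‖J k ω‖} ∪ ⋃ k, {ω | ENNReal.ofReal (t k) ≤ edist (J k ω) (I k ω)} := by
  rintro ω ⟨k, (hk : 2 * t k < ‖I k ω‖)⟩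
  refine (lt_or_ge (t k) ‖J k ω‖).imp (fun h => ⟨k, h⟩) fun h => Set.mem_iUnion.2 ⟨k, ?_⟩
  rw [Set.mem_ofPred_eq, edist_dist, dist_comm, dist_eq_norm]
  exact ENNReal.ofReal_le_ofReal (by linarith [norm_sub_norm_le (I k ω) (J k ω), hk])

lemma measure_exists_norm_gt_le_of_simpleFunc [Fintype κ] (hα : 0 < α)
    {f : κ → (Fin N → ℝ) → ℂ} {I : κ → Ω → ℂ} (hI : ∀ k, IsStableIntegral α P M (f k) (I k))
    {t : κ → ℝ} (ht : ∀ k, 0 < t k) {a b : ℝ≥0∞} (ha : a ≠ ∞)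
    (hsimple : ∀ G : SimpleFunc (Fin N → ℝ) (κ → ℂ), G.FinMeasSupp volume →
      P {ω | ∃ k, t k < ‖simpleIntegral M (G.map (· k)) ω‖} ≤ a * (∫⁻ x, ‖G x‖ₑ ^ α) + b) :
    P {ω | ∃ k, 2 * t k < ‖I k ω‖} ≤ a * (2 ^ α * ∫⁻ x, ⨆ k, ‖f k x‖ₑ ^ α) + b := by
  choose g hg hgf hgI using fun k => (hI k).exists_approx
  let S : ℝ≥0∞ := ∫⁻ x, ⨆ k, ‖f k x‖ₑ ^ α
  let err (n : ℕ) : ℝ≥0∞ := ∑ k, ∫⁻ x, ‖g k n x - f k x‖ₑ ^ α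
  let dev (n : ℕ) : ℝ≥0∞ :=
    ∑ k, P {ω | ENNReal.ofReal (t k) ≤ edist (simpleIntegral M (g k n) ω) (I k ω)}
  have hLp : ∀ n, ∫⁻ x, ‖simplePi (fun k => g k n) x‖ₑ ^ α ≤ 2 ^ α * (S + err n) := by
    intro n
    have hmeas : ∀ k, AEMeasurable fun x => ‖g k n x - f k x‖ₑ ^ α := fun k =>
      ((g k n).measurable.aemeasurable.sub
        (hI k).memLp.aestronglyMeasurable.aemeasurable).enorm.pow_const _
    calc ∫⁻ x, ‖simplePi (fun k => g k n) x‖ₑ ^ α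
        ≤ ∫⁻ x, 2 ^ α * ((⨆ k, ‖f k x‖ₑ ^ α) + ∑ k, ‖g k n x - f k x‖ₑ ^ α) :=
          lintegral_mono fun x => enorm_pi_rpow_le_iSup_add_sum hα _ fun k => f k x
      _ = 2 ^ α * (S + err n) := by
          rw [lintegral_const_mul' _ _ (by simp),
            lintegral_add_right' _ (Finset.aemeasurable_fun_sum _ fun k _ => hmeas k),
            lintegral_finsetSum' _ fun k _ => hmeas k]
  have hbound : ∀ n, P {ω | ∃ k, 2 * t k < ‖I k ω‖} ≤ a * (2 ^ α * (S + err n)) + b + dev n := by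
    intro n
    refine (measure_mono (setOf_exists_two_mul_lt_norm_subset t)).trans
      ((measure_union_le _ _).trans (add_le_add ?_ (measure_iUnion_fintype_le P _)))
    exact (hsimple _ (finMeasSupp_simplePi fun k => hg k n)).trans (by gcongr; exact hLp n)
  have herr : Tendsto err atTop (𝓝 0) := by
    simpa using tendsto_finsetSum Finset.univ fun k _ =>
      tendsto_lintegral_enorm_rpow_of_tendsto_eLpNorm hα (hgf k)
  have hdev : Tendsto dev atTop (𝓝 0) := by
    simpa using tendsto_finsetSum Finset.univ fun k _ =>
      hgI k (ENNReal.ofReal (t k)) (ENNReal.ofReal_pos.2 (ht k))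
  have hlim := ((ENNReal.Tendsto.const_mul (ENNReal.Tendsto.const_mul (herr.const_add S)
    (Or.inr (by simp : (2 : ℝ≥0∞) ^ α ≠ ∞))) (Or.inr ha)).add_const b).add hdev
  simp only [add_zero] at hlim
  exact ge_of_tendsto' hlim hbound

lemma measure_exists_le_of_finset [Countable κ] {p : κ → Ω → Prop} {b : ℝ≥0∞}
    (h : ∀ F : Finset κ, P {ω | ∃ k : F, p k ω} ≤ b) : P {ω | ∃ k, p k ω} ≤ b := by
  have hUnion : {ω | ∃ k, p k ω} = ⋃ F : Finset κ, {ω | ∃ k : F, p k ω} := by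
    ext ω
    simp only [Set.mem_ofPred_eq, Set.mem_iUnion]
    exact ⟨fun ⟨k, hk⟩ => ⟨{k}, ⟨k, Finset.mem_singleton_self k⟩, hk⟩, fun ⟨_, k, hk⟩ => ⟨k, hk⟩⟩
  have hmono : Monotone fun F : Finset κ => {ω | ∃ k : F, p k ω} :=
    fun _ _ hFG _ ⟨k, hk⟩ => ⟨⟨k, hFG k.2⟩, hk⟩
  rw [hUnion, hmono.directed_le.measure_iUnion]
  exact iSup_le h

lemma measure_exists_norm_gt_le_of_finset_simpleFunc [Countable κ] (hα : 0 < α)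
    {f : κ → (Fin N → ℝ) → ℂ} {I : κ → Ω → ℂ} (hI : ∀ k, IsStableIntegral α P M (f k) (I k))
    {t : κ → ℝ} (ht : ∀ k, 0 < t k) {a b : ℝ≥0∞} (ha : a ≠ ∞)
    (hsimple : ∀ (F : Finset κ) (G : SimpleFunc (Fin N → ℝ) (F → ℂ)), G.FinMeasSupp volume →
      P {ω | ∃ k : F, t k < ‖simpleIntegral M (G.map (· k)) ω‖} ≤ a * (∫⁻ x, ‖G x‖ₑ ^ α) + b) :
    P {ω | ∃ k, 2 * t k < ‖I k ω‖} ≤ a * (2 ^ α * ∫⁻ x, ⨆ k, ‖f k x‖ₑ ^ α) + b := by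
  refine measure_exists_le_of_finset (p := fun k ω => 2 * t k < ‖I k ω‖) fun F =>
    (measure_exists_norm_gt_le_of_simpleFunc hα (fun k : F => hI k) (fun k => ht k) ha
      (hsimple F)).trans ?_
  gcongr with x
  exact iSup_comp_le (fun k => ‖f k x‖ₑ ^ α) ((↑) : F → κ)

lemma IsStableRandomMeasure.measure_exists_norm_gt_le_of_lt_one [IsProbabilityMeasure P]
    (hM : IsStableRandomMeasure α P M) (hα : 0 < α) (hα1 : α < 1) [Countable κ]
    {f : κ → (Fin N → ℝ) → ℂ} {I : κ → Ω → ℂ} (hI : ∀ k, IsStableIntegral α P M (f k) (I k))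
    {t : ℝ} (ht : 0 < t) :
    P {ω | ∃ k, 2 * t < ‖I k ω‖} ≤
      ENNReal.ofReal (tailConst α 1 * t ^ (-α)) * (2 ^ α * ∫⁻ x, ⨆ k, ‖f k x‖ₑ ^ α) := by
  simpa only [add_zero] using measure_exists_norm_gt_le_of_finset_simpleFunc hα hI (fun _ => ht)
    (b := 0) ENNReal.ofReal_ne_top fun F G hG =>
      (hM.measure_exists_simpleIntegral_gt_le_of_lt_one hα hα1 hG ht).trans (add_zero _).ge

lemma IsStableRandomMeasure.measure_exists_norm_gt_le_of_lt_two [IsProbabilityMeasure P]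
    (hM : IsStableRandomMeasure α P M) (hα : 0 < α) (hα2 : α < 2) [Countable κ]
    {f : κ → (Fin N → ℝ) → ℂ} {I : κ → Ω → ℂ} (hI : ∀ k, IsStableIntegral α P M (f k) (I k))
    {t : κ → ℝ} (ht : ∀ k, 0 < t k) {y : ℝ} (hy : 0 < y) :
    P {ω | ∃ k, 2 * t k < ‖I k ω‖} ≤
      ENNReal.ofReal (tailConst α 2 * y ^ (-(α / 2))) * (2 ^ α * ∫⁻ x, ⨆ k, ‖f k x‖ₑ ^ α) +
        ∑' k, 4 * ENNReal.ofReal (Real.exp (-(t k ^ 2 / (8 * y)))) := by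
  refine measure_exists_norm_gt_le_of_finset_simpleFunc hα hI ht ENNReal.ofReal_ne_top
    fun F G hG => ?_
  refine (hM.measure_exists_simpleIntegral_gt_le_of_lt_two hα hα2 hG (fun k => (ht k).le)
    hy).trans ?_
  gcongr
  rw [Finset.sum_coe_sort F fun k => 4 * ENNReal.ofReal (Real.exp (-(t k ^ 2 / (8 * y))))]
  exact ENNReal.sum_le_tsum F

end StableIntegral

section AlmostSureBound

variable {Ω ι κ E : Type*} [MeasurableSpace Ω] {P : Measure Ω} [NormedAddCommGroup E]

lemma ae_exists_forall_norm_le_mul_of_tendsto_tsum [Countable ι] {X : ι → κ → Ω → E}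
    {W : ι → κ → ℝ}
    (h : Tendsto (fun x => ∑' i, P {ω | ∃ k, x * W i k < ‖X i k ω‖}) atTop (𝓝 0)) :
    ∀ᵐ ω ∂P, ∃ T : ℝ, ∀ i k, ‖X i k ω‖ ≤ T * W i k := by
  rw [ae_iff]
  refine le_antisymm (ge_of_tendsto' h fun x => ?_) zero_le
  refine (measure_mono fun ω hω => ?_).trans (measure_iUnion_le _)
  have hω : ∀ T : ℝ, ∃ i k, T * W i k < ‖X i k ω‖ := by
    simpa only [Set.mem_ofPred_eq, not_exists, not_forall, not_le] using hω
  exact Set.mem_iUnion.2 (hω x)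

variable [MeasurableSpace E] [OpensMeasurableSpace E] [Countable ι] {X : ι → Ω → E}

lemma exists_measurable_forall_norm_le_mul (hX : ∀ i, Measurable (X i)) {W : ι → ℝ}
    (hW : ∀ i, 0 < W i) :
    ∃ C : Ω → ℝ, Measurable C ∧ (∀ ω, 0 < C ω) ∧
      ∀ ω, (∃ T : ℝ, ∀ i, ‖X i ω‖ ≤ T * W i) → ∀ i, ‖X i ω‖ ≤ C ω * W i := by
  let R (ω : Ω) : ℝ≥0∞ := ⨆ i, ENNReal.ofReal (‖X i ω‖ / W i)
  refine ⟨fun ω => 1 + (R ω).toReal, ?_, fun ω => by positivity, ?_⟩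
  · exact measurable_const.add
      (Measurable.iSup fun i => ((hX i).norm.div_const _).ennreal_ofReal).ennreal_toReal
  · rintro ω ⟨T, hT⟩ i
    have hR : R ω ≤ ENNReal.ofReal T := iSup_le fun i =>
      ENNReal.ofReal_le_ofReal ((div_le_iff₀ (hW i)).2 (hT i))
    have hle : ‖X i ω‖ / W i ≤ (R ω).toReal :=
      (ENNReal.ofReal_le_iff_le_toReal (ne_top_of_le_ne_top ENNReal.ofReal_ne_top hR)).1
        (le_iSup (fun i => ENNReal.ofReal (‖X i ω‖ / W i)) i)
    exact (div_le_iff₀ (hW i)).1 (by linarith)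

lemma exists_measurableSet_forall_norm_le_mul [IsProbabilityMeasure P]
    (hX : ∀ i, Measurable (X i)) {W : ℝ → ι → ℝ} (hW : ∀ η i, 0 < W η i) (hWmono : Monotone W)
    (hbound : ∀ η, 0 < η → ∀ᵐ ω ∂P, ∃ T : ℝ, ∀ i, ‖X i ω‖ ≤ T * W η i) :
    ∃ Ωstar : Set Ω, MeasurableSet Ωstar ∧ P Ωstar = 1 ∧
      ∀ η : ℝ, 0 < η → ∃ C : Ω → ℝ, Measurable C ∧ (∀ ω, 0 < C ω) ∧
        ∀ ω ∈ Ωstar, ∀ i, ‖X i ω‖ ≤ C ω * W η i := by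
  have hall : ∀ᵐ ω ∂P, ∀ n : ℕ, ∃ T : ℝ, ∀ i, ‖X i ω‖ ≤ T * W (1 / (n + 1)) i :=
    ae_all_iff.2 fun n => hbound _ (by positivity)
  obtain ⟨s, hs, hsm, hsX⟩ := hall.exists_measurable_mem
  refine ⟨s, hsm, (mem_ae_iff_prob_eq_one hsm).1 hs, fun η hη => ?_⟩
  obtain ⟨C, hCm, hC0, hC⟩ := exists_measurable_forall_norm_le_mul hX (hW η)
  refine ⟨C, hCm, hC0, fun ω hω => hC ω ?_⟩
  obtain ⟨n, hn⟩ := exists_nat_one_div_lt hη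
  obtain ⟨T, hT⟩ := hsX ω hω n
  refine ⟨|T|, fun i => (hT i).trans ?_⟩
  calc T * W (1 / (n + 1)) i ≤ |T| * W (1 / (n + 1)) i :=
        mul_le_mul_of_nonneg_right (le_abs_self T) (hW _ i).le
    _ ≤ |T| * W η i := mul_le_mul_of_nonneg_left (hWmono hn.le i) (abs_nonneg T)

end AlmostSureBound

lemma ofReal_mul_mul_rpow {C x w b : ℝ} (hx : 0 ≤ x) (hw : 0 ≤ w) :
    ENNReal.ofReal (C * (x * w) ^ b) =
      ENNReal.ofReal (C * x ^ b) * ENNReal.ofReal (w ^ b) := by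
  rw [Real.mul_rpow hx hw, ← mul_assoc, ENNReal.ofReal_mul' (by positivity)]

lemma tendsto_ofReal_mul_rpow_neg_mul {C b : ℝ} (hb : 0 < b) {D : ℝ≥0∞} (hD : D ≠ ∞) :
    Tendsto (fun x : ℝ => ENNReal.ofReal (C * x ^ (-b)) * D) atTop (𝓝 0) := by
  have h := ENNReal.Tendsto.mul_const
    (ENNReal.tendsto_ofReal ((tendsto_rpow_neg_atTop hb).const_mul C)) (Or.inr hD)
  rwa [mul_zero, ENNReal.ofReal_zero, zero_mul] at h

namespace IsStableRandomMeasure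

variable {N : ℕ} {Ω : Type*} [MeasurableSpace Ω] {α : ℝ} {P : Measure Ω} [IsProbabilityMeasure P]
  {M : Set (Fin N → ℝ) → Ω → ℂ} {ι κ : Type*} [Countable ι] [Countable κ]
  {f : ι → κ → (Fin N → ℝ) → ℂ} {I : ι → κ → Ω → ℂ} {S : ℝ≥0∞} {w : ι → ℝ}

theorem ae_exists_forall_norm_le_of_lt_one (hM : IsStableRandomMeasure α P M) (hα : 0 < α)
    (hα1 : α < 1) (hI : ∀ i k, IsStableIntegral α P M (f i k) (I i k)) (hS : S ≠ ∞)
    (hfS : ∀ i, ∫⁻ x, ⨆ k, ‖f i k x‖ₑ ^ α ≤ S) (hw : ∀ i, 0 < w i)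
    (hsum : ∑' i, ENNReal.ofReal (w i ^ (-α)) ≠ ∞) :
    ∀ᵐ ω ∂P, ∃ T : ℝ, ∀ i k, ‖I i k ω‖ ≤ T * w i := by
  suffices h : ∀ᵐ ω ∂P, ∃ T : ℝ, ∀ i k, ‖I i k ω‖ ≤ T * (2 * w i) by
    filter_upwards [h] with ω ⟨T, hT⟩
    exact ⟨T * 2, fun i k => by simpa only [mul_assoc] using hT i k⟩
  refine ae_exists_forall_norm_le_mul_of_tendsto_tsum <|
    tendsto_of_tendsto_of_tendsto_of_le_of_le' tendsto_const_nhds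
      (tendsto_ofReal_mul_rpow_neg_mul (C := tailConst α 1) hα
        (ENNReal.mul_ne_top hsum (by finiteness : 2 ^ α * S ≠ ∞)))
      (Eventually.of_forall fun x => zero_le) ?_
  filter_upwards [eventually_gt_atTop 0] with x hx
  rw [← mul_assoc, ← ENNReal.tsum_mul_left, ← ENNReal.tsum_mul_right]
  refine ENNReal.tsum_le_tsum fun i => ?_
  rw [mul_left_comm, ← ofReal_mul_mul_rpow hx.le (hw i).le]
  refine (hM.measure_exists_norm_gt_le_of_lt_one hα hα1 (hI i) (mul_pos hx (hw i))).trans ?_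
  gcongr
  exact hfS i

lemma measure_exists_norm_gt_mul_sqrt_le (hM : IsStableRandomMeasure α P M) (hα : 0 < α)
    (hα2 : α < 2) {f : κ → (Fin N → ℝ) → ℂ} {I : κ → Ω → ℂ}
    (hI : ∀ k, IsStableIntegral α P M (f k) (I k)) {w : ℝ} (hw : 0 < w) {L : κ → ℝ}
    (hL : ∀ k, 0 < L k) {x : ℝ} (hx : 0 < x) :
    P {ω | ∃ k, 2 * (x * (w * √(L k))) < ‖I k ω‖} ≤
      ENNReal.ofReal (tailConst α 2 * x ^ (-(α / 2))) *
        (ENNReal.ofReal (w ^ (-α)) * (2 ^ α * ∫⁻ z, ⨆ k, ‖f k z‖ₑ ^ α)) +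
          4 * ∑' k, ENNReal.ofReal (Real.exp (-(x / 8 * L k))) := by
  have hpow : w ^ (-α) = (w ^ 2) ^ (-(α / 2)) := by
    rw [← Real.rpow_two, ← Real.rpow_mul hw.le, mul_neg, mul_div_cancel₀ α two_ne_zero]
  have hexponent : ∀ k, x / 8 * L k = (x * (w * √(L k))) ^ 2 / (8 * (x * w ^ 2)) := by
    intro k
    rw [mul_pow, mul_pow, Real.sq_sqrt (hL k).le]
    field_simp
  simp only [hpow, hexponent, ← mul_assoc (ENNReal.ofReal _), ← ENNReal.tsum_mul_left,
    ← ofReal_mul_mul_rpow hx.le (sq_nonneg w)]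
  rw [mul_assoc]
  exact hM.measure_exists_norm_gt_le_of_lt_two hα hα2 hI
    (fun k => mul_pos hx (mul_pos hw (Real.sqrt_pos.2 (hL k)))) (by positivity)

theorem ae_exists_forall_norm_le_of_lt_two (hM : IsStableRandomMeasure α P M) (hα : 0 < α)
    (hα2 : α < 2) (hI : ∀ i k, IsStableIntegral α P M (f i k) (I i k)) (hS : S ≠ ∞)
    (hfS : ∀ i, ∫⁻ x, ⨆ k, ‖f i k x‖ₑ ^ α ≤ S) (hw : ∀ i, 0 < w i)
    (hsum : ∑' i, ENNReal.ofReal (w i ^ (-α)) ≠ ∞) {L : ι → κ → ℝ} (hL : ∀ i k, 0 < L i k)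
    (hLsum : Tendsto (fun x => ∑' i, ∑' k, ENNReal.ofReal (Real.exp (-(x * L i k))))
      atTop (𝓝 0)) :
    ∀ᵐ ω ∂P, ∃ T : ℝ, ∀ i k, ‖I i k ω‖ ≤ T * (w i * √(L i k)) := by
  suffices h : ∀ᵐ ω ∂P, ∃ T : ℝ, ∀ i k, ‖I i k ω‖ ≤ T * (2 * (w i * √(L i k))) by
    filter_upwards [h] with ω ⟨T, hT⟩
    exact ⟨T * 2, fun i k => by simpa only [mul_assoc] using hT i k⟩
  have hexp := ENNReal.Tendsto.const_mul (a := 4)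
    (hLsum.comp (tendsto_id.atTop_div_const (by norm_num : (0 : ℝ) < 8))) (Or.inr (by simp))
  have hlim := (tendsto_ofReal_mul_rpow_neg_mul (C := tailConst α 2) (half_pos hα)
    (ENNReal.mul_ne_top hsum (by finiteness : 2 ^ α * S ≠ ∞))).add hexp
  rw [mul_zero, add_zero] at hlim
  refine ae_exists_forall_norm_le_mul_of_tendsto_tsum <|
    tendsto_of_tendsto_of_tendsto_of_le_of_le' tendsto_const_nhds hlim
      (Eventually.of_forall fun x => zero_le) ?_
  filter_upwards [eventually_gt_atTop 0] with x hx
  simp only [Function.comp_apply, id, ← ENNReal.tsum_mul_left, ← ENNReal.tsum_mul_right,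
    ← ENNReal.tsum_add]
  refine ENNReal.tsum_le_tsum fun i => ?_
  rw [ENNReal.tsum_mul_left]
  simp only [mul_left_comm x 2]
  refine (hM.measure_exists_norm_gt_mul_sqrt_le hα hα2 (hI i) (hw i) (hL i) hx).trans ?_
  gcongr
  exact hfS i

end IsStableRandomMeasure

section FourierTransform

variable (g : ℝ → ℂ) (ξ : ℝ)

lemma fourierU_const_mul (c : ℂ) : fourierU (fun s => c * g s) ξ = c * fourierU g ξ := by
  simp only [fourierU, mul_left_comm _ c, integral_const_mul]

lemma fourierU_comp_mul_left {a : ℝ} (ha : a ≠ 0) :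
    fourierU (fun s => g (a * s)) ξ = ((|a⁻¹| : ℝ) : ℂ) * fourierU g (a⁻¹ * ξ) := by
  have hsubst := Measure.integral_comp_mul_left
    (fun v : ℝ => Complex.exp (-(Complex.I * v * (a⁻¹ * ξ : ℝ))) * g v) a
  have hphase : ∀ s : ℝ, Complex.I * (a * s : ℝ) * (a⁻¹ * ξ : ℝ) = Complex.I * s * ξ := by
    intro s
    have ha' : (a : ℂ) ≠ 0 := Complex.ofReal_ne_zero.2 ha
    push_cast
    field_simp
  simp only [hphase, Complex.real_smul] at hsubst
  rw [fourierU, fourierU, hsubst, mul_left_comm]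

lemma norm_fourierU_comp_sub_right (b : ℝ) :
    ‖fourierU (fun s => g (s - b)) ξ‖ = ‖fourierU g ξ‖ := by
  have hphase : ∀ s : ℝ, Complex.exp (-(Complex.I * (s + b : ℝ) * ξ)) * g s =
      Complex.exp ((-(b * ξ) : ℝ) * Complex.I) * (Complex.exp (-(Complex.I * s * ξ)) * g s) := by
    intro s
    rw [← mul_assoc, ← Complex.exp_add]
    push_cast
    ring_nf
  have hsubst := integral_add_right_eq_self (μ := volume)
    (fun s : ℝ => Complex.exp (-(Complex.I * s * ξ)) * g (s - b)) b
  simp only [add_sub_cancel_right, hphase, integral_const_mul] at hsubst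
  rw [fourierU, fourierU, ← hsubst, norm_mul, norm_mul, norm_mul,
    Complex.norm_exp_ofReal_mul_I, one_mul]

end FourierTransform

lemma lintegral_eq_ofReal_abs_prod_mul_lintegral_comp_mul {ι : Type*} [Fintype ι] {a : ι → ℝ}
    (ha : ∀ i, a i ≠ 0) (f : (ι → ℝ) → ℝ≥0∞) :
    ∫⁻ x, f x = ENNReal.ofReal |∏ i, a i| * ∫⁻ x, f (a * x) := by
  classical
  have hdiag : ⇑(Matrix.toLin' (Matrix.diagonal a)) =
      Homeomorph.piCongrRight fun i => Homeomorph.mulLeft₀ (a i) (ha i) := by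
    ext x i
    simp [Matrix.mulVec_diagonal]
  have hvol := Real.smul_map_diagonal_volume_pi (D := a)
    (by rw [Matrix.det_diagonal]; exact Finset.prod_ne_zero_iff.2 fun i _ => ha i)
  rw [Matrix.det_diagonal, hdiag] at hvol
  conv_lhs => rw [← hvol]
  rw [lintegral_smul_measure, (Homeomorph.measurableEmbedding _).lintegral_map, smul_eq_mul]
  rfl

section Wavelets

variable {N : ℕ} (α : ℝ) (ψ : 𝓢(ℝ, ℝ))

lemma norm_fourierU_psi (j k : ℤ) (ξ : ℝ) :
    ‖fourierU (psi ψ j k) ξ‖ =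
      2 ^ (-(j : ℝ) / 2) * ‖fourierU (fun x => (ψ x : ℂ)) ((2 ^ j)⁻¹ * ξ)‖ := by
  have hpsi : psi ψ j k = fun s : ℝ => (((2 : ℝ) ^ ((j : ℝ) / 2) : ℝ) : ℂ) *
      (fun v : ℝ => (ψ (v - k) : ℂ)) (2 ^ j * s) := by
    ext s
    exact Complex.ofReal_mul _ _
  have hpow : (2 : ℝ) ^ ((j : ℝ) / 2) * (2 ^ j)⁻¹ = 2 ^ (-(j : ℝ) / 2) := by
    rw [← Real.rpow_intCast, ← Real.rpow_neg zero_le_two, ← Real.rpow_add two_pos]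
    ring_nf
  rw [hpsi, fourierU_const_mul, fourierU_comp_mul_left (fun v => (ψ (v - k) : ℂ)) ξ (by positivity),
    norm_mul, norm_mul, norm_fourierU_comp_sub_right fun x => (ψ x : ℂ),
    Complex.norm_of_nonneg (by positivity), Complex.norm_of_nonneg (abs_nonneg _),
    abs_of_pos (by positivity), ← mul_assoc, hpow]

lemma norm_hatPsi (j k : ℤ) (ξ : ℝ) :
    ‖hatPsi α ψ j k ξ‖ =
      ((2 ^ j)⁻¹) ^ (1 / α) * ‖fourierU (fun x => (ψ x : ℂ)) ((2 ^ j)⁻¹ * ξ)‖ := by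
  rw [hatPsi, norm_mul, norm_fourierU_psi, Complex.norm_of_nonneg (by positivity), ← mul_assoc,
    ← Real.rpow_add two_pos, ← Real.rpow_intCast, ← Real.rpow_neg zero_le_two,
    ← Real.rpow_mul zero_le_two]
  ring_nf

lemma norm_hatPsiTensor (J K : Fin N → ℤ) (x : Fin N → ℝ) :
    ‖hatPsiTensor α ψ J K x‖ =
      (∏ l, ((2 : ℝ) ^ J l)⁻¹) ^ (1 / α) * ‖hatPsiTensor α ψ 0 0 ((fun l => (2 ^ J l)⁻¹) * x)‖ := by
  simp only [hatPsiTensor, norm_prod, norm_hatPsi, Pi.zero_apply, Pi.mul_apply, zpow_zero,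
    inv_one, one_mul, Real.one_rpow, Finset.prod_mul_distrib]
  rw [Real.finsetProd_rpow _ _ fun l _ => by positivity]

variable {α}

theorem lintegral_iSup_enorm_conj_hatPsiTensor_rpow (hα : 0 < α) (J : Fin N → ℤ) :
    ∫⁻ x, ⨆ K, ‖conj (hatPsiTensor α ψ J K x)‖ₑ ^ α =
      ∫⁻ x : Fin N → ℝ, ‖hatPsiTensor α ψ 0 0 x‖ₑ ^ α := by
  set D : Fin N → ℝ := fun l => (2 ^ J l)⁻¹
  have hD : ∀ l, 0 < D l := fun l => by positivity
  have hprod : 0 < ∏ l, D l := Finset.prod_pos fun l _ => hD l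
  have hscale : ∀ K x, ‖conj (hatPsiTensor α ψ J K x)‖ₑ ^ α =
      ENNReal.ofReal |∏ l, D l| * ‖hatPsiTensor α ψ 0 0 (D * x)‖ₑ ^ α := by
    intro K x
    rw [← ofReal_norm, RCLike.norm_conj, norm_hatPsiTensor, ENNReal.ofReal_mul (by positivity),
      ENNReal.mul_rpow_of_nonneg _ _ hα.le, ofReal_norm,
      ENNReal.ofReal_rpow_of_nonneg (by positivity) hα.le, ← Real.rpow_mul hprod.le,
      one_div_mul_cancel hα.ne', Real.rpow_one, abs_of_pos hprod]
  simp only [hscale, ciSup_const]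
  rw [lintegral_const_mul' _ _ ENNReal.ofReal_ne_top,
    ← lintegral_eq_ofReal_abs_prod_mul_lintegral_comp_mul (fun l => (hD l).ne')
      fun x => ‖hatPsiTensor α ψ 0 0 x‖ₑ ^ α]

lemma lintegral_enorm_hatPsiTensor_rpow_ne_top (hα : 0 < α) {J K : Fin N → ℤ}
    (h : MemLp (fun x => conj (hatPsiTensor α ψ J K x)) (ENNReal.ofReal α) volume) :
    ∫⁻ x, ‖hatPsiTensor α ψ J K x‖ₑ ^ α ≠ ∞ := by
  have hfin := lintegral_rpow_enorm_lt_top_of_eLpNorm_lt_top (by simpa using hα)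
    ENNReal.ofReal_ne_top h.2
  simpa only [RCLike.enorm_conj, ENNReal.toReal_ofReal hα.le] using hfin.ne

end Wavelets

section ExponentialSums

variable {ι κ : Type*}

lemma tsum_pi_fin_succ {N : ℕ} (F : (Fin (N + 1) → κ) → ℝ≥0∞) :
    ∑' n, F n = ∑' k, ∑' n, F (Fin.cons k n) := by
  rw [← (Fin.consEquiv fun _ => κ).tsum_eq, ENNReal.tsum_prod']
  rfl

lemma tsum_pi_prod (p : κ → ℝ≥0∞) (N : ℕ) :
    ∑' n : Fin N → κ, ∏ l, p (n l) = (∑' k, p k) ^ N := by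
  induction N with
  | zero => simp
  | succ N ih =>
    simp only [tsum_pi_fin_succ, Fin.prod_univ_succ, Fin.cons_zero, Fin.cons_succ,
      ENNReal.tsum_mul_left, ih, ENNReal.tsum_mul_right, pow_succ']

lemma tendsto_tsum_exp_neg_mul_of_tsum_ne_top {a : ι → ℝ} {c x₀ : ℝ} (hc : 0 < c)
    (ha : ∀ i, c ≤ a i) (h : ∑' i, ENNReal.ofReal (Real.exp (-(x₀ * a i))) ≠ ∞) :
    Tendsto (fun x => ∑' i, ENNReal.ofReal (Real.exp (-(x * a i)))) atTop (𝓝 0) := by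
  have hdecay : Tendsto (fun x => Real.exp (-((x - x₀) * c))) atTop (𝓝 0) :=
    Real.tendsto_exp_neg_atTop_nhds_zero.comp
      ((tendsto_atTop_add_const_right _ (-x₀) tendsto_id).atTop_mul_const hc)
  have hlim := ENNReal.Tendsto.mul_const (ENNReal.tendsto_ofReal hdecay) (Or.inr h)
  rw [ENNReal.ofReal_zero, zero_mul] at hlim
  refine tendsto_of_tendsto_of_tendsto_of_le_of_le' tendsto_const_nhds hlim
    (Eventually.of_forall fun x => zero_le) ?_
  filter_upwards [eventually_ge_atTop x₀] with x hx
  rw [← ENNReal.tsum_mul_left]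
  refine ENNReal.tsum_le_tsum fun i => ?_
  rw [← ENNReal.ofReal_mul (by positivity), ← Real.exp_add]
  gcongr
  linarith [mul_le_mul_of_nonneg_left (ha i) (sub_nonneg.2 hx)]

lemma tendsto_tsum_tsum_exp_neg_mul_mul {a : ι → ℝ} {b : κ → ℝ} {c d : ℝ} (hc : 0 < c)
    (hd : 0 < d) (ha : ∀ i, c ≤ a i) (hb : ∀ k, d ≤ b k)
    (hsuma : Tendsto (fun x => ∑' i, ENNReal.ofReal (Real.exp (-(x * a i)))) atTop (𝓝 0))
    (hsumb : Tendsto (fun x => ∑' k, ENNReal.ofReal (Real.exp (-(x * b k)))) atTop (𝓝 0)) :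
    Tendsto (fun x => ∑' i, ∑' k, ENNReal.ofReal (Real.exp (-(x * (a i * b k)))))
      atTop (𝓝 0) := by
  have hlim := ENNReal.Tendsto.mul
    (hsuma.comp (tendsto_id.atTop_mul_const (half_pos hd))) (Or.inr (by simp))
    (hsumb.comp (tendsto_id.atTop_mul_const (half_pos hc))) (Or.inr (by simp))
  rw [zero_mul] at hlim
  refine tendsto_of_tendsto_of_tendsto_of_le_of_le' tendsto_const_nhds hlim
    (Eventually.of_forall fun x => zero_le) ?_
  filter_upwards [eventually_ge_atTop 0] with x hx
  simp only [Function.comp_apply, id]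
  rw [← ENNReal.tsum_mul_right]
  refine ENNReal.tsum_le_tsum fun i => ?_
  rw [← ENNReal.tsum_mul_left]
  refine ENNReal.tsum_le_tsum fun k => ?_
  rw [← ENNReal.ofReal_mul (by positivity), ← Real.exp_add]
  gcongr
  have hab : d / 2 * a i + c / 2 * b k ≤ a i * b k := by nlinarith [ha i, hb k]
  linarith [mul_le_mul_of_nonneg_left hab hx]

lemma tendsto_tsum_pi_exp_neg_mul_prod {a : κ → ℝ} {c : ℝ} (hc : 0 < c) (ha : ∀ k, c ≤ a k)
    (h : Tendsto (fun x => ∑' k, ENNReal.ofReal (Real.exp (-(x * a k)))) atTop (𝓝 0)) (N : ℕ) :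
    Tendsto (fun x => ∑' n : Fin N → κ, ENNReal.ofReal (Real.exp (-(x * ∏ l, a (n l)))))
      atTop (𝓝 0) := by
  induction N with
  | zero => simpa using ENNReal.tendsto_ofReal Real.tendsto_exp_neg_atTop_nhds_zero
  | succ N ih =>
    have hprod : ∀ n : Fin N → κ, c ^ N ≤ ∏ l, a (n l) := fun n => by
      simpa using Finset.prod_le_prod (s := Finset.univ) (fun _ _ => hc.le) fun l _ => ha (n l)
    simpa only [tsum_pi_fin_succ, Fin.prod_univ_succ, Fin.cons_zero, Fin.cons_succ] using
      tendsto_tsum_tsum_exp_neg_mul_mul hc (pow_pos hc N) ha hprod h ih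

end ExponentialSums

section Weights

variable {N : ℕ} {s : ℝ} (n : Fin N → ℤ)

/-- The polynomial weight `∏_l (1 + |n_l|)^s` of a multi-index. -/
noncomputable def polyWeight (s : ℝ) (n : Fin N → ℤ) : ℝ := ∏ l, (1 + |(n l : ℝ)|) ^ s

/-- The logarithmic weight `∏_l log (2 + |n_l|)` of a multi-index; the shift by `2` bounds each
factor away from zero. -/
noncomputable def logWeight (n : Fin N → ℤ) : ℝ := ∏ l, Real.log (2 + |(n l : ℝ)|)

lemma polyWeight_pos : 0 < polyWeight s n := Finset.prod_pos fun l _ => by positivity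

lemma polyWeight_rpow (t : ℝ) : polyWeight s n ^ t = polyWeight (s * t) n := by
  rw [polyWeight, ← Real.finsetProd_rpow _ _ fun l _ => by positivity]
  exact Finset.prod_congr rfl fun l _ => (Real.rpow_mul (by positivity) s t).symm

lemma monotone_polyWeight : Monotone fun s => polyWeight s n := fun _ _ hst =>
  Finset.prod_le_prod (fun l _ => by positivity) fun l _ =>
    Real.rpow_le_rpow_of_exponent_le (by linarith [abs_nonneg (n l : ℝ)]) hst

lemma tsum_one_add_abs_rpow_ne_top (hs : s < -1) :
    ∑' k : ℤ, ENNReal.ofReal ((1 + |(k : ℝ)|) ^ s) ≠ ∞ := by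
  refine (Summable.of_norm_bounded_eventually
    (Real.summable_abs_int_rpow (b := -s) (by linarith)) ?_).tsum_ofReal_ne_top
  filter_upwards [(Set.finite_singleton (0 : ℤ)).compl_mem_cofinite] with k hk
  rw [Real.norm_of_nonneg (by positivity), neg_neg]
  exact Real.rpow_le_rpow_of_nonpos (by simpa using hk) (by linarith) (by linarith)

lemma tsum_polyWeight_ne_top (hs : s < -1) :
    ∑' n : Fin N → ℤ, ENNReal.ofReal (polyWeight s n) ≠ ∞ := by
  have hprod : ∀ n : Fin N → ℤ, ENNReal.ofReal (polyWeight s n) =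
      ∏ l, ENNReal.ofReal ((1 + |(n l : ℝ)|) ^ s) := fun n =>
    ENNReal.ofReal_prod_of_nonneg fun l _ => by positivity
  simp only [hprod, tsum_pi_prod fun k : ℤ => ENNReal.ofReal ((1 + |(k : ℝ)|) ^ s)]
  exact ENNReal.pow_ne_top (tsum_one_add_abs_rpow_ne_top hs)

lemma tsum_polyWeight_rpow_neg_ne_top {α η : ℝ} (hα : 0 < α) (hη : 0 < η) :
    ∑' n : Fin N → ℤ, ENNReal.ofReal (polyWeight (1 / α + η) n ^ (-α)) ≠ ∞ := by
  have hexponent : (1 / α + η) * -α < -1 := by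
    rw [mul_neg, add_mul, one_div_mul_cancel hα.ne']
    linarith [mul_pos hη hα]
  simpa only [polyWeight_rpow] using tsum_polyWeight_ne_top hexponent

lemma log_two_le_log_two_add_abs (k : ℤ) : Real.log 2 ≤ Real.log (2 + |(k : ℝ)|) :=
  Real.log_le_log two_pos (by linarith [abs_nonneg (k : ℝ)])

lemma log_two_pow_le_logWeight : Real.log 2 ^ N ≤ logWeight n := by
  simpa [logWeight] using Finset.prod_le_prod (s := Finset.univ)
    (fun _ _ => (Real.log_pos one_lt_two).le)
    fun l _ => log_two_le_log_two_add_abs (n l)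

lemma logWeight_pos : 0 < logWeight n :=
  (pow_pos (Real.log_pos one_lt_two) N).trans_le (log_two_pow_le_logWeight n)

lemma polyWeight_mul_sqrt_logWeight_mul (J K : Fin N → ℤ) :
    polyWeight s J * √(logWeight J * logWeight K) =
      ∏ l, ((1 + |(J l : ℝ)|) ^ s * √(Real.log (2 + |(J l : ℝ)|)) *
        √(Real.log (2 + |(K l : ℝ)|))) := by
  have hlog : ∀ k : ℤ, 0 ≤ Real.log (2 + |(k : ℝ)|) := fun k =>
    Real.log_nonneg (by linarith [abs_nonneg (k : ℝ)])
  rw [Real.sqrt_mul (logWeight_pos J).le, logWeight, logWeight, Real.sqrt_prod _ fun l _ => hlog _,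
    Real.sqrt_prod _ fun l _ => hlog _, polyWeight, ← mul_assoc, Finset.prod_mul_distrib,
    Finset.prod_mul_distrib]

lemma tendsto_tsum_exp_neg_mul_logWeight :
    Tendsto (fun x => ∑' n : Fin N → ℤ, ENNReal.ofReal (Real.exp (-(x * logWeight n))))
      atTop (𝓝 0) := by
  have hlog : 0 < Real.log 2 := Real.log_pos one_lt_two
  refine tendsto_tsum_pi_exp_neg_mul_prod hlog log_two_le_log_two_add_abs
    (tendsto_tsum_exp_neg_mul_of_tsum_ne_top (x₀ := 2) hlog log_two_le_log_two_add_abs ?_) N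
  refine ne_top_of_le_ne_top (tsum_one_add_abs_rpow_ne_top (s := -2) (by norm_num))
    (ENNReal.tsum_le_tsum fun k => ENNReal.ofReal_le_ofReal ?_)
  calc Real.exp (-(2 * Real.log (2 + |(k : ℝ)|))) = (2 + |(k : ℝ)|) ^ (-2 : ℝ) := by
        rw [Real.rpow_def_of_pos (by positivity)]
        ring_nf
    _ ≤ (1 + |(k : ℝ)|) ^ (-2 : ℝ) :=
        Real.rpow_le_rpow_of_nonpos (by positivity) (by linarith) (by norm_num)

lemma tendsto_tsum_tsum_exp_neg_mul_logWeight_mul :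
    Tendsto (fun x => ∑' J : Fin N → ℤ, ∑' K : Fin N → ℤ,
      ENNReal.ofReal (Real.exp (-(x * (logWeight J * logWeight K))))) atTop (𝓝 0) :=
  have hpos := pow_pos (Real.log_pos one_lt_two) N
  tendsto_tsum_tsum_exp_neg_mul_mul hpos hpos log_two_pow_le_logWeight log_two_pow_le_logWeight
    tendsto_tsum_exp_neg_mul_logWeight tendsto_tsum_exp_neg_mul_logWeight

end Weights

namespace IsStableRandomMeasure

variable {N : ℕ} {Ω : Type*} [MeasurableSpace Ω] {α η : ℝ} {ψ : 𝓢(ℝ, ℝ)} {P : Measure Ω}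
  [IsProbabilityMeasure P] {M : Set (Fin N → ℝ) → Ω → ℂ} {ε : (Fin N → ℤ) → (Fin N → ℤ) → Ω → ℂ}

theorem ae_exists_forall_waveletCoeff_le_of_lt_one (hM : IsStableRandomMeasure α P M)
    (hα : 0 < α) (hα1 : α < 1)
    (hε : ∀ J K, IsStableIntegral α P M (fun x => conj (hatPsiTensor α ψ J K x)) (ε J K))
    (hη : 0 < η) :
    ∀ᵐ ω ∂P, ∃ T : ℝ, ∀ J K, ‖ε J K ω‖ ≤ T * polyWeight (1 / α + η) J :=
  hM.ae_exists_forall_norm_le_of_lt_one hα hα1 hε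
    (lintegral_enorm_hatPsiTensor_rpow_ne_top ψ hα (hε 0 0).memLp)
    (fun J => (lintegral_iSup_enorm_conj_hatPsiTensor_rpow ψ hα J).le)
    polyWeight_pos (tsum_polyWeight_rpow_neg_ne_top hα hη)

theorem ae_exists_forall_waveletCoeff_le_of_lt_two (hM : IsStableRandomMeasure α P M)
    (hα : 0 < α) (hα2 : α < 2)
    (hε : ∀ J K, IsStableIntegral α P M (fun x => conj (hatPsiTensor α ψ J K x)) (ε J K))
    (hη : 0 < η) :
    ∀ᵐ ω ∂P, ∃ T : ℝ, ∀ J K,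
      ‖ε J K ω‖ ≤ T * (polyWeight (1 / α + η) J * √(logWeight J * logWeight K)) :=
  hM.ae_exists_forall_norm_le_of_lt_two hα hα2 hε
    (lintegral_enorm_hatPsiTensor_rpow_ne_top ψ hα (hε 0 0).memLp)
    (fun J => (lintegral_iSup_enorm_conj_hatPsiTensor_rpow ψ hα J).le)
    polyWeight_pos (tsum_polyWeight_rpow_neg_ne_top hα hη)
    (fun J K => mul_pos (logWeight_pos J) (logWeight_pos K))
    tendsto_tsum_tsum_exp_neg_mul_logWeight_mul

end IsStableRandomMeasure

end HFSS

theorem mainTheorem4_general {N : ℕ} {α : ℝ} (hα0 : 0 < α) (hα2 : α < 2) (ψ : 𝓢(ℝ, ℝ))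
    {Ω : Type*} [MeasurableSpace Ω] (P : Measure Ω) [IsProbabilityMeasure P]
    (M : Set (Fin N → ℝ) → Ω → ℂ) (hM : HFSS.IsStableRandomMeasure α P M)
    (ε : (Fin N → ℤ) → (Fin N → ℤ) → Ω → ℂ)
    (hε : ∀ J K, HFSS.IsStableIntegral α P M
      (fun x => conj (HFSS.hatPsiTensor α ψ J K x)) (ε J K)) :
    ∃ Ωstar : Set Ω, MeasurableSet Ωstar ∧ P Ωstar = 1 ∧
      ∀ η : ℝ, 0 < η → ∃ C : Ω → ℝ, Measurable C ∧ (∀ ω, 0 < C ω) ∧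
        (α < 1 → ∀ ω ∈ Ωstar, ∀ J K : Fin N → ℤ,
          ‖ε J K ω‖ ≤ C ω * ∏ l, (1 + |(J l : ℝ)|) ^ (1 / α + η)) ∧
        (1 ≤ α → ∀ ω ∈ Ωstar, ∀ J K : Fin N → ℤ,
          ‖ε J K ω‖ ≤ C ω * ∏ l, ((1 + |(J l : ℝ)|) ^ (1 / α + η) *
            √(Real.log (2 + |(J l : ℝ)|)) * √(Real.log (2 + |(K l : ℝ)|)))) := by
  have hε_meas := fun i : (Fin N → ℤ) × (Fin N → ℤ) => (hε i.1 i.2).measurable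
  have hw := fun η (J : Fin N → ℤ) => HFSS.polyWeight_pos (s := 1 / α + η) J
  have hw_mono : Monotone fun η (J : Fin N → ℤ) => HFSS.polyWeight (1 / α + η) J :=
    fun _ _ hη J => HFSS.monotone_polyWeight J (add_le_add_right hη _)
  rcases lt_or_ge α 1 with hα1 | hα1
  · obtain ⟨Ωstar, hΩm, hΩ, h⟩ := HFSS.exists_measurableSet_forall_norm_le_mul (P := P) hε_meas
      (fun η i => hw η i.1) (fun _ _ hη i => hw_mono hη i.1) fun η hη =>
      (hM.ae_exists_forall_waveletCoeff_le_of_lt_one hα0 hα1 hε hη).mono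
        fun ω ⟨T, hT⟩ => ⟨T, fun i => hT i.1 i.2⟩
    refine ⟨Ωstar, hΩm, hΩ, fun η hη => ?_⟩
    obtain ⟨C, hCm, hC0, hC⟩ := h η hη
    exact ⟨C, hCm, hC0, fun _ ω hω J K => hC ω hω (J, K), fun h => absurd hα1 h.not_gt⟩
  · obtain ⟨Ωstar, hΩm, hΩ, h⟩ := HFSS.exists_measurableSet_forall_norm_le_mul (P := P) hε_meas
      (fun η i => mul_pos (hw η i.1) (Real.sqrt_pos.2
        (mul_pos (HFSS.logWeight_pos i.1) (HFSS.logWeight_pos i.2))))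
      (fun _ _ hη i => mul_le_mul_of_nonneg_right (hw_mono hη i.1) (Real.sqrt_nonneg _))
      fun η hη => (hM.ae_exists_forall_waveletCoeff_le_of_lt_two hα0 hα2 hε hη).mono
        fun ω ⟨T, hT⟩ => ⟨T, fun i => hT i.1 i.2⟩
    refine ⟨Ωstar, hΩm, hΩ, fun η hη => ?_⟩
    obtain ⟨C, hCm, hC0, hC⟩ := h η hη
    exact ⟨C, hCm, hC0, fun h => absurd h hα1.not_gt, fun _ ω hω J K =>
      (hC ω hω (J, K)).trans_eq (by rw [HFSS.polyWeight_mul_sqrt_logWeight_mul])⟩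

theorem mainTheorem4 {N : ℕ} {α : ℝ} (hα0 : 0 < α) (hα2 : α < 2)
    (ψ : 𝓢(ℝ, ℝ)) (hψ : HFSS.IsLemarieMeyer ψ)
    {Ω : Type*} [MeasurableSpace Ω] (P : Measure Ω) [IsProbabilityMeasure P]
    (M : Set (Fin N → ℝ) → Ω → ℂ) (hM : HFSS.IsStableRandomMeasure α P M)
    (ε : (Fin N → ℤ) → (Fin N → ℤ) → Ω → ℂ)
    (hε : ∀ J K, HFSS.IsStableIntegral α P M
      (fun x => conj (HFSS.hatPsiTensor α ψ J K x)) (ε J K)) :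
    ∃ Ωstar : Set Ω, MeasurableSet Ωstar ∧ P Ωstar = 1 ∧
      ∀ η : ℝ, 0 < η → ∃ C : Ω → ℝ, Measurable C ∧ (∀ ω, 0 < C ω) ∧
        (α < 1 → ∀ ω ∈ Ωstar, ∀ J K : Fin N → ℤ,
          ‖ε J K ω‖ ≤ C ω * ∏ l, (1 + |(J l : ℝ)|) ^ (1 / α + η)) ∧
        (1 ≤ α → ∀ ω ∈ Ωstar, ∀ J K : Fin N → ℤ,
          ‖ε J K ω‖ ≤ C ω * ∏ l, ((1 + |(J l : ℝ)|) ^ (1 / α + η) *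
            √(Real.log (2 + |(J l : ℝ)|)) * √(Real.log (2 + |(K l : ℝ)|)))) :=
  mainTheorem4_general hα0 hα2 ψ P M hM ε hε
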